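/- A rectilinear polygon is a closed region of the plane that is a finite union of axes-parallel rectangles (closed, with sides of positive length) and has connected interior. A reflex vertex of it is a vertex with internal angle $270^\circ$. Let $C$ (the "cake") be a simply-connected rectilinear polygon with exactly $T$ reflex vertices, and let $Z_1,\dots,Z_m$ (the "toppings"), $m\ge 0$, be axes-parallel rectangles contained in $C$ with pairwise disjoint interiors. Then there are an integer $b\ge 0$ with $$b\le m+T-\lceil 2\sqrt m-1\rceil$$ and axes-parallel rectangles $Z'_1,\dots,Z'_{m+b}$ with pairwise disjoint interiors such that $C=Z'_1\cup\dots\cup Z'_{m+b}$ and $Z_i\subseteq Z'_i$ for all $i\le m$. Moreover, for all integers $m\ge 0$ and $T\ge 0$ there are a simply-connected rectilinear polygon $C$ with exactly $T$ reflex vertices and pairwise disjoint axes-parallel rectangles $Z_1,\dots,Z_m\subseteq C$ such that the smallest $b$ for which a partition of $C$ into $m+b$ rectangles as above exists is exactly $m+T-\lceil 2\sqrt m-1\rceil$. -/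

import Mathlib

/-- An axes-parallel rectangle in the plane: a closed box `[a₁, b₁] × [a₂, b₂]` with both sides of
positive length. -/
def IsAxisRect (R : Set (ℝ × ℝ)) : Prop :=
  ∃ a b : ℝ × ℝ, a.1 < b.1 ∧ a.2 < b.2 ∧ R = Set.Icc a b

/-- A simply-connected rectilinear (axes-parallel) polygon, as a closed region of the plane:
a finite union of axes-parallel rectangles, with connected interior (so it is not several polygons
that merely touch in points), and simply connected (so it has no holes, and its boundary does not
touch itself: a loop through such a touching point would not be contractible). -/
structure IsSimplyConnectedRectilinearPolygon (C : Set (ℝ × ℝ)) : Prop where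
  exists_rects : ∃ S : Set (Set (ℝ × ℝ)), S.Finite ∧ (∀ R ∈ S, IsAxisRect R) ∧ C = ⋃₀ S
  interior_connected : IsConnected (interior C)
  simply_connected : IsSimplyConnected C

/-- `p` is a reflex vertex of the closed rectilinear region `C` (internal angle 270 degrees):
near `p`, the region `C` is the plane without exactly one of the four open quadrants at `p`.
The signs of `s` and `t` say which quadrant is missing. -/
def IsReflexVertex (C : Set (ℝ × ℝ)) (p : ℝ × ℝ) : Prop :=
  ∃ s t : ℝ, (s = 1 ∨ s = -1) ∧ (t = 1 ∨ t = -1) ∧ ∃ ε : ℝ, 0 < ε ∧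
    ∀ q : ℝ × ℝ, |q.1 - p.1| < ε → |q.2 - p.2| < ε →
      (q ∈ C ↔ ¬ (0 < s * (q.1 - p.1) ∧ 0 < t * (q.2 - p.2)))

/-- `C` has a partition into `m + b` axes-parallel rectangles with pairwise disjoint interiors,
`C = Z'₁ ⊔ ⋯ ⊔ Z'_{m+b}`, where the `i`-th piece contains the topping `Zᵢ` for every `i ≤ m`;
the other `b` pieces are the blanks. -/
def HasExpansion (C : Set (ℝ × ℝ)) {m : ℕ} (Z : Fin m → Set (ℝ × ℝ)) (b : ℕ) : Prop :=
  ∃ P : Fin (m + b) → Set (ℝ × ℝ),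
    (∀ j, IsAxisRect (P j)) ∧
    (∀ j k, j ≠ k → Disjoint (interior (P j)) (interior (P k))) ∧
    (⋃ j, P j) = C ∧
    ∀ i : Fin m, Z i ⊆ P (Fin.castAdd b i)

/-! Upper bound. Among the tilings of `C` with the toppings in distinct rectangles, take one with
the fewest rectangles, say `n`, and let `P` be the `m` rectangles that hold toppings. Sides that
touch form horizontal and vertical segments. Since the interior of `C` is connected, so is the
contact graph of the rectangles, and it stays connected if only those contacts are kept that end at
the right (or upper) end of a segment or at a gap, that is, at a reflex vertex inside a side
(`reachable_of_adj`). Counting these contacts gives `n ≤ h + v + T + 1`, where `h` and `v` are the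
numbers of horizontal and vertical free segments, those without gaps (`card_le_terminal`,
`ncard_terminal_le`, `ncard_gapPoints_le`).

A free segment has a rectangle of `P` on each of its two sides; otherwise pushing it into the side
without one would delete a rectangle (`IsSegment.improves`). Hence, if a property of segments passes
from the bottom to the top of every rectangle in `P`, the free segments inject into `P` so as to
miss all rectangles at which the property begins (`ncard_add_ncard_cross_le`). Let `c` be the length
of a longest chain in `P` in which each rectangle stands on the segment at the top of the previous
one. Sorting `P` into `c` levels, some level has `a ≥ m / c` rectangles, so `h ≤ m - a`. The longest
chain itself separates the vertical segments into left and right ones, so `v ≤ m - c`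
(`exists_ncard_free_add_le`). Thus `n ≤ 2m + T + 1 - (a + c)`, and `m ≤ a c` gives `a + c ≥ 2√m`.

Lower bound. Wide and tall toppings alternate in a checkerboard, so any four neighbours form a
pinwheel. The cake is a square with a descending staircase of `T` steps attached. The middles of the
pinwheels and the outer corners of the steps are points that no piece with a topping can contain,
and no blank can contain two of them (`HasExpansion.card_le`). A nearly square arrangement has
enough pinwheels (`exists_pinwheel_count`). -/

/-! ### Tilings, their sides and their segments -/

/-- A family of axes-parallel rectangles `[l i, r i] × [b i, t i]` with pairwise disjoint
interiors. -/
structure Tiling (ι : Type*) where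
  (l r b t : ι → ℝ)
  l_lt_r : ∀ i, l i < r i
  b_lt_t : ∀ i, b i < t i
  sep : ∀ i j, i ≠ j → r i ≤ l j ∨ r j ≤ l i ∨ t i ≤ b j ∨ t j ≤ b i

namespace Tiling

variable {ι : Type*} (X : Tiling ι)

/-- The tiling reflected in the diagonal. -/
def swap : Tiling ι where
  l := X.b
  r := X.t
  b := X.l
  t := X.r
  l_lt_r := X.b_lt_t
  b_lt_t := X.l_lt_r
  sep i j h := by have := X.sep i j h; tauto

/-- The height of the bottom side `(i, false)` or of the top side `(i, true)` of a rectangle. -/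
def height (n : ι × Bool) : ℝ := if n.2 = true then X.t n.1 else X.b n.1

/-- Two rectangles whose horizontal projections overlap. -/
def Overlap (i j : ι) : Prop := X.l i < X.r j ∧ X.l j < X.r i

/-- A top side and a bottom side that touch along a segment of positive length. -/
def Adj (n n' : ι × Bool) : Prop :=
  n'.2 = !n.2 ∧ X.height n = X.height n' ∧ X.Overlap n.1 n'.1

variable {X}

theorem Overlap.symm {i j : ι} (h : X.Overlap i j) : X.Overlap j i := ⟨h.2, h.1⟩

theorem Adj.symm {n n' : ι × Bool} (h : X.Adj n n') : X.Adj n' n :=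
  ⟨by simp [h.1], h.2.1.symm, h.2.2.symm⟩

theorem Overlap.sep {i j : ι} (h : X.Overlap i j) (hij : i ≠ j) :
    X.t i ≤ X.b j ∨ X.t j ≤ X.b i := by
  have := X.sep i j hij
  obtain ⟨h1, h2⟩ := h
  rcases this with h | h | h | h
  · linarith
  · linarith
  · exact Or.inl h
  · exact Or.inr h

/-- Both rectangles lie on the same side of their common height, so if they were distinct their
interiors would meet near it. -/
theorem eq_of_overlap {n n' : ι × Bool} (h : n.2 = n'.2) (hh : X.height n = X.height n')
    (ho : X.Overlap n.1 n'.1) : n = n' := by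
  obtain ⟨i, s⟩ := n
  obtain ⟨j, s'⟩ := n'
  simp only at h ho
  subst h
  by_contra hne
  have hij : i ≠ j := fun h => hne (by rw [h])
  have h1 := X.b_lt_t i
  have h2 := X.b_lt_t j
  cases s <;> simp only [height] at hh <;> rcases ho.sep hij with h | h <;> simp at hh <;> linarith

/-- A rectangle that extends beyond a side, on the other side of it, is adjacent to that side. -/
theorem adj_of_cover {n : ι × Bool} {d : ι} (ho : X.Overlap n.1 d)
    (ht : n.2 = true → X.b d ≤ X.height n ∧ X.height n < X.t d)
    (hf : n.2 = false → X.b d < X.height n ∧ X.height n ≤ X.t d) : X.Adj n (d, !n.2) := by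
  obtain ⟨i, s⟩ := n
  refine ⟨rfl, ?_, ho⟩
  simp only [height] at *
  have h1 := X.b_lt_t i
  have hid : i ≠ d := by
    rintro rfl
    cases s <;> simp at ht hf
  cases s <;> simp at ht hf ⊢ <;> rcases ho.sep hid with h | h <;> linarith

variable (X) in
/-- The connected components of adjacent sides, that is, the segments of the tiling. -/
def segSetoid : Setoid (ι × Bool) where
  r := Relation.ReflTransGen X.Adj
  iseqv := ⟨fun _ => .refl,
    fun h => by
      induction h with
      | refl => exact .refl
      | tail _ h ih => exact .head h.symm ih,
    fun h h' => h.trans h'⟩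

variable (X) in
/-- The segment that contains a side. -/
def seg (n : ι × Bool) : Quotient X.segSetoid := Quotient.mk _ n

theorem seg_eq_iff {n n' : ι × Bool} : X.seg n = X.seg n' ↔ Relation.ReflTransGen X.Adj n n' :=
  Quotient.eq (r := X.segSetoid)

theorem Adj.seg_eq {n n' : ι × Bool} (h : X.Adj n n') : X.seg n = X.seg n' :=
  seg_eq_iff.2 (.single h)

theorem height_eq_of_seg_eq {n n' : ι × Bool} (h : X.seg n = X.seg n') :
    X.height n = X.height n' := by
  rw [seg_eq_iff] at h
  induction h with
  | refl => rfl
  | tail _ h ih => exact ih.trans h.2.1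

/-- A property of sides that adjacent sides in a segment share holds on the whole segment. -/
theorem seg_induction {n n' : ι × Bool} (h : X.seg n = X.seg n') (p : ι × Bool → Prop) (hn : p n)
    (hp : ∀ u v, X.seg u = X.seg n → X.Adj u v → p u → p v) : p n' := by
  have h' := seg_eq_iff.1 h
  clear h
  induction h' with
  | refl => exact hn
  | tail h1 h2 ih => exact hp _ _ (seg_eq_iff.2 h1).symm h2 ih

/-! ### Gaps along a segment -/

variable (X) in
/-- At the right end of `n'`, the side `n` goes on, but nothing on the other side of it does. -/
def EGap (n n' : ι × Bool) : Prop :=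
  X.Adj n n' ∧ X.r n'.1 < X.r n.1 ∧
    ∀ u, X.Adj n u → X.l u.1 ≤ X.r n'.1 → X.r u.1 ≤ X.r n'.1

variable (X) in
/-- At the left end of `n'`, the side `n` goes on, but nothing on the other side of it does. -/
def WGap (n n' : ι × Bool) : Prop :=
  X.Adj n n' ∧ X.l n.1 < X.l n'.1 ∧
    ∀ u, X.Adj n u → X.l n'.1 ≤ X.r u.1 → X.l n'.1 ≤ X.l u.1

/-- Nothing opposite `n` continues past `x`. Among the opposite sides that start beyond `x`, the
leftmost one starts at a gap. -/
theorem exists_wGap [Finite ι] {n n₁ : ι × Bool} {x : ℝ} (h : X.Adj n n₁) (hx : X.l n.1 ≤ x)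
    (hx₁ : x < X.l n₁.1) (hu : ∀ u, X.Adj n u → X.l u.1 ≤ x → X.r u.1 ≤ x) :
    ∃ n', X.WGap n n' := by
  obtain ⟨n', ⟨h1, h2⟩, h3⟩ := Set.exists_min_image {u | X.Adj n u ∧ x < X.l u.1} (fun u => X.l u.1)
    (Set.toFinite _) ⟨n₁, h, hx₁⟩
  refine ⟨n', h1, by linarith, fun u hau hru => ?_⟩
  by_contra hlt
  push Not at hlt
  rcases le_or_gt (X.l u.1) x with hl | hl
  · linarith [hu u hau hl]
  · linarith [h3 u ⟨hau, hl⟩]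

theorem exists_eGap [Finite ι] {n n₁ : ι × Bool} {x : ℝ} (h : X.Adj n n₁) (hx : x < X.r n.1)
    (hx₁ : X.r n₁.1 ≤ x) (hu : ∀ u, X.Adj n u → X.l u.1 ≤ x → X.r u.1 ≤ x) :
    ∃ n', X.EGap n n' := by
  obtain ⟨n', ⟨h1, h2⟩, h3⟩ := Set.exists_max_image {u | X.Adj n u ∧ X.r u.1 ≤ x} (fun u => X.r u.1)
    (Set.toFinite _) ⟨n₁, h, hx₁⟩
  refine ⟨n', h1, by linarith, fun u hau hru => ?_⟩
  exact h3 u ⟨hau, hu u hau (by linarith)⟩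

/-- A side without gaps is covered from its other side, if it is touched there at all. -/
theorem exists_cover [Finite ι] {n n₁ : ι × Bool} {x : ℝ} (h : X.Adj n n₁)
    (hE : ∀ n', ¬ X.EGap n n') (hW : ∀ n', ¬ X.WGap n n') (hx : X.l n.1 ≤ x) (hx' : x < X.r n.1) :
    ∃ u, X.Adj n u ∧ X.l u.1 ≤ x ∧ x < X.r u.1 := by
  by_contra! hu
  rcases lt_or_ge x (X.l n₁.1) with h1 | h1
  · obtain ⟨n', h'⟩ := exists_wGap h hx h1 hu
    exact hW n' h'
  · obtain ⟨n', h'⟩ := exists_eGap h hx' (hu _ h h1) hu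
    exact hE n' h'

theorem exists_cover_closed [Finite ι] {n n₁ : ι × Bool} {x : ℝ} (h : X.Adj n n₁)
    (hE : ∀ n', ¬ X.EGap n n') (hW : ∀ n', ¬ X.WGap n n') (hx : X.l n.1 ≤ x) (hx' : x ≤ X.r n.1) :
    ∃ u, X.Adj n u ∧ X.l u.1 ≤ x ∧ x ≤ X.r u.1 := by
  rcases hx'.lt_or_eq with hlt | rfl
  · obtain ⟨u, h1, h2, h3⟩ := exists_cover h hE hW hx hlt
    exact ⟨u, h1, h2, h3.le⟩
  obtain ⟨u, h1, h3⟩ := Set.exists_max_image {u | X.Adj n u} (fun u => X.r u.1)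
    (Set.toFinite _) ⟨n₁, h⟩
  refine ⟨u, h1, h1.2.2.2.le, ?_⟩
  by_contra! hlt
  obtain ⟨v, hv, hv1, hv2⟩ := exists_cover h hE hW h1.2.2.1.le hlt
  exact absurd (h3 v hv) (not_le.2 hv2)

/-- If no side of a segment passes over `q`, the segment lies on one side of `q`. -/
theorem r_le_of_seg_eq {n n' : ι × Bool} {q : ℝ} (h : X.seg n = X.seg n')
    (hq : ∀ u, X.seg u = X.seg n → X.l u.1 < q → X.r u.1 ≤ q) (hn : X.r n.1 ≤ q) :
    X.r n'.1 ≤ q := by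
  refine seg_induction h (fun u => X.r u.1 ≤ q) hn fun u v hu huv hr => ?_
  exact hq v (huv.seg_eq.symm.trans hu) (huv.2.2.2.trans_le hr)

theorem snd_eq_or {n n' u : ι × Bool} (h : X.Adj n n') : u.2 = n.2 ∨ u.2 = n'.2 := by
  rw [h.1]
  cases u.2 <;> cases n.2 <;> simp

/-- A side of the segment passing over this right end would be of the same kind as `n` or `n'` and
overlap it. So a flush contact marks the right end of the whole segment. -/
theorem r_le_of_flush {n n' u : ι × Bool} (h : X.Adj n n') (hr : X.r n.1 = X.r n'.1)
    (hu : X.seg u = X.seg n) : X.r u.1 ≤ X.r n.1 := by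
  refine r_le_of_seg_eq hu.symm (fun v hv hl => ?_) le_rfl
  by_contra! hlt
  rcases snd_eq_or (u := v) h with h2 | h2
  · have := eq_of_overlap h2 (height_eq_of_seg_eq hv)
      ⟨hl, (X.l_lt_r n.1).trans hlt⟩
    rw [this] at hlt
    exact lt_irrefl _ hlt
  · have := eq_of_overlap h2 (height_eq_of_seg_eq (hv.trans h.seg_eq))
      ⟨hr ▸ hl, (X.l_lt_r n'.1).trans (hr ▸ hlt)⟩
    rw [this, hr] at hlt
    exact lt_irrefl _ hlt

theorem flush_unique {n n' u u' : ι × Bool} (h : X.Adj n n') (hr : X.r n.1 = X.r n'.1)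
    (hu : X.Adj u u') (hru : X.r u.1 = X.r u'.1) (hs : n.2 = u.2) (hseg : X.seg n = X.seg u) :
    n = u ∧ n' = u' := by
  have e : X.r n.1 = X.r u.1 := le_antisymm (r_le_of_flush hu hru hseg)
    (r_le_of_flush h hr hseg.symm)
  refine ⟨eq_of_overlap hs (height_eq_of_seg_eq hseg) ⟨e ▸ X.l_lt_r _, e ▸ X.l_lt_r _⟩,
    eq_of_overlap (X := X) (by rw [h.1, hu.1, hs]) ?_ ⟨?_, ?_⟩⟩
  · rw [← h.2.1, ← hu.2.1, height_eq_of_seg_eq hseg]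
  · rw [← hru, ← e, hr]; exact X.l_lt_r _
  · rw [← hr, e, hru]; exact X.l_lt_r _

/-- If nothing touched `a` again after its gap, the segment would end with `a`. The flush contact at
the right end would then involve `a`, and its partner would touch `a` after the gap. So contact with
`a` resumes, and where it does there is a gap facing the other way. -/
theorem exists_wGap_of_flush [Finite ι] {n n' a a' : ι × Bool} (h : X.Adj n n')
    (hr : X.r n.1 = X.r n'.1) (ha : X.EGap a a') (hseg : X.seg a = X.seg n) :
    ∃ u u', X.WGap u u' ∧ X.seg u = X.seg n := by
  by_contra! hno
  have hW : ∀ u', ¬ X.WGap a u' := fun u' hu => hno a u' hu hseg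
  obtain ⟨haa, hlt, hgap⟩ := ha
  have hle : ∀ u, X.Adj a u → X.r u.1 ≤ X.r a'.1 := by
    intro u hu
    by_contra! hlt'
    have : X.r a'.1 < X.l u.1 := by
      by_contra! hle
      exact absurd (hgap u hu hle) (not_le.2 hlt')
    obtain ⟨w, hw⟩ := exists_wGap hu haa.2.2.1.le this hgap
    exact hW w hw
  have hall : ∀ u, X.seg a = X.seg u → X.r u.1 ≤ X.r a.1 := by
    intro u hu
    refine r_le_of_seg_eq hu (fun v hv hl => ?_) le_rfl
    by_contra! hlt'
    rcases snd_eq_or (u := v) haa with h2 | h2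
    · have := eq_of_overlap h2 (height_eq_of_seg_eq hv) ⟨hl, (X.l_lt_r a.1).trans hlt'⟩
      rw [this] at hlt'
      exact lt_irrefl _ hlt'
    · have hav : X.Adj a v := ⟨by rw [h2, haa.1], (height_eq_of_seg_eq hv).symm,
        ⟨(X.l_lt_r a.1).trans hlt', hl⟩⟩
      linarith [hle v hav]
  have e : X.r n.1 = X.r a.1 := le_antisymm (hall n hseg) (r_le_of_flush h hr hseg)
  rcases snd_eq_or (u := a) h with h2 | h2
  · have := eq_of_overlap h2 (height_eq_of_seg_eq hseg) ⟨e ▸ X.l_lt_r _, e ▸ X.l_lt_r _⟩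
    subst this
    linarith [hle _ h]
  · have := eq_of_overlap h2 (height_eq_of_seg_eq (hseg.trans h.seg_eq))
      ⟨hr ▸ e ▸ X.l_lt_r _, (hr.symm.trans e) ▸ X.l_lt_r _⟩
    subst this
    linarith [hle _ h.symm]

/-! ### Free segments -/

variable (X) in
/-- A segment between rectangles, none of whose ends lies at a gap. -/
def Free (κ : Quotient X.segSetoid) : Prop :=
  (∃ n n', X.seg n = κ ∧ X.Adj n n') ∧
    ∀ n n', X.seg n = κ → ¬ X.EGap n n' ∧ ¬ X.WGap n n'

/-- Every side in a free segment is adjacent to another one. -/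
theorem Free.exists_adj {n : ι × Bool} (h : X.Free (X.seg n)) : ∃ n', X.Adj n n' := by
  obtain ⟨⟨u, u', hu, huu⟩, -⟩ := h
  have := seg_eq_iff.1 hu.symm
  rcases Relation.ReflTransGen.cases_head this with rfl | ⟨v, hv, -⟩
  · exact ⟨_, huu⟩
  · exact ⟨v, hv⟩

theorem Free.exists_cover [Finite ι] {n : ι × Bool} (h : X.Free (X.seg n)) {x : ℝ}
    (hx : X.l n.1 ≤ x) (hx' : x < X.r n.1) : ∃ u, X.Adj n u ∧ X.l u.1 ≤ x ∧ x < X.r u.1 :=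
  have ⟨_, h1⟩ := h.exists_adj
  Tiling.exists_cover h1 (fun n' => (h.2 n n' rfl).1) (fun n' => (h.2 n n' rfl).2) hx hx'

theorem Free.exists_cover_closed [Finite ι] {n : ι × Bool} (h : X.Free (X.seg n)) {x : ℝ}
    (hx : X.l n.1 ≤ x) (hx' : x ≤ X.r n.1) : ∃ u, X.Adj n u ∧ X.l u.1 ≤ x ∧ x ≤ X.r u.1 :=
  have ⟨_, h1⟩ := h.exists_adj
  Tiling.exists_cover_closed h1 (fun n' => (h.2 n n' rfl).1) (fun n' => (h.2 n n' rfl).2) hx hx'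

/-! ### Terminal contacts connect the tiling -/

variable (X) in
/-- The contact of the top side of `i` with the bottom side of `j` ends at the right end of their
segment, or at a gap. -/
def Terminal (i j : ι) : Prop :=
  X.Adj (i, true) (j, false) ∧
    (X.r i = X.r j ∨ X.EGap (i, true) (j, false) ∨ X.EGap (j, false) (i, true))

/-- As there is no gap, something opposite `n` continues past the end of `n'`; if it started earlier
it would overlap `n'`. -/
theorem exists_next {n n' : ι × Bool} (h : X.Adj n n') (hr : X.r n'.1 < X.r n.1)
    (hg : ¬ X.EGap n n') :
    ∃ d, X.Adj n (d, n'.2) ∧ X.l d = X.r n'.1 ∧ X.r n'.1 < X.r d := by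
  have : ∃ u, X.Adj n u ∧ X.l u.1 ≤ X.r n'.1 ∧ X.r n'.1 < X.r u.1 := by
    by_contra! hno
    exact hg ⟨h, hr, hno⟩
  obtain ⟨⟨d, s⟩, hu, hl, hlt⟩ := this
  have hs : s = n'.2 := by rw [h.1]; exact hu.1
  subst hs
  refine ⟨d, hu, le_antisymm hl ?_, hlt⟩
  by_contra! hl'
  have := eq_of_overlap (n := n') (n' := (d, n'.2)) rfl (h.2.1.symm.trans hu.2.1)
    ⟨(X.l_lt_r _).trans hlt, hl'⟩
  rw [this] at hlt
  exact lt_irrefl _ hlt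

/-- At the right end of a contact that is not terminal, a third rectangle `d` begins next to the
shorter of the two. The contact of `i` and `j` is then replaced by two contacts through `d`, each
either terminal or ending further up or to the right. -/
theorem reachable_step {R : ι → ι → Prop} (hR : Equivalence R)
    (h1 : ∀ i j, X.Terminal i j → R i j) (h2 : ∀ i j, X.swap.Terminal i j → R i j) {i j : ι}
    (h : X.Adj (i, true) (j, false))
    (ih1 : ∀ i' j', X.Adj (i', true) (j', false) →
      min (X.r i) (X.r j) + X.t i < min (X.r i') (X.r j') + X.t i' → R i' j')
    (ih2 : ∀ i' j', X.swap.Adj (i', true) (j', false) →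
      min (X.r i) (X.r j) + X.t i < min (X.t i') (X.t j') + X.r i' → R i' j') : R i j := by
  by_contra hno
  have hT : ¬ X.Terminal i j := fun h => hno (h1 _ _ h)
  simp only [Terminal, h, true_and, not_or] at hT
  obtain ⟨hne, hE1, hE2⟩ := hT
  have hij : X.t i = X.b j := by simpa [height] using h.2.1
  rcases lt_or_gt_of_ne hne with hlt | hlt
  -- Here `i` and `d` hang side by side from `j`. Their tops are level, so their vertical contact is
  -- terminal.
  · obtain ⟨d, hd, hld, hrd⟩ := exists_next h.symm hlt hE2
    simp only at hld hrd
    have hdj : X.t d = X.b j := by simpa [height] using hd.2.1.symm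
    have e1 := X.b_lt_t i
    have e2 := X.b_lt_t d
    refine hno (hR.trans (h2 i d ⟨⟨rfl, ?_, ?_, ?_⟩, Or.inl ?_⟩) (ih1 d j hd.symm ?_))
    · simp [height, swap, hld]
    · simp only [swap]; linarith
    · simp only [swap]; linarith
    · simp only [swap]; linarith
    · rw [min_eq_left hlt.le, hdj, hij]
      have := lt_min hrd hlt
      linarith
  · obtain ⟨d, hd, hld, hrd⟩ := exists_next h hlt hE1
    simp only at hld hrd
    have hid : X.t i = X.b d := by simpa [height] using hd.2.1
    have e1 := X.b_lt_t j
    have e2 := X.b_lt_t d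
    refine hno (hR.trans (ih1 i d hd ?_) (hR.symm (ih2 j d ⟨rfl, ?_, ?_, ?_⟩ ?_)))
    · rw [min_eq_right hlt.le]
      have := lt_min hlt hrd
      linarith
    · simp [height, swap, hld]
    · simp only [swap]; linarith
    · simp only [swap]; linarith
    · rw [min_eq_right hlt.le]
      have := lt_min (hij ▸ e1 : X.t i < X.t j) (hid ▸ e2 : X.t i < X.t d)
      linarith

theorem reachable_of_adj [Finite ι] {R : ι → ι → Prop} (hR : Equivalence R)
    (h1 : ∀ i j, X.Terminal i j → R i j) (h2 : ∀ i j, X.swap.Terminal i j → R i j) :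
    (∀ i j, X.Adj (i, true) (j, false) → R i j) ∧
      ∀ i j, X.swap.Adj (i, true) (j, false) → R i j := by
  let A : Bool → ι → ι → Prop := fun s i j =>
    if s then X.Adj (i, true) (j, false) else X.swap.Adj (i, true) (j, false)
  -- The sum of the coordinates of the right (or upper) end of a contact; a bad contact maximizing
  -- it is contradictory.
  let f : Bool → ι → ι → ℝ := fun s i j =>
    if s then min (X.r i) (X.r j) + X.t i else min (X.t i) (X.t j) + X.r i
  suffices H : ∀ s i j, A s i j → R i j from
    ⟨fun i j h => H true i j (by simpa [A]), fun i j h => H false i j (by simpa [A])⟩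
  by_contra! hbad
  obtain ⟨s, i, j, hA, hn⟩ := hbad
  obtain ⟨⟨s, i, j⟩, ⟨hA, hn⟩, hmax⟩ := Set.exists_max_image
    {p : Bool × ι × ι | A p.1 p.2.1 p.2.2 ∧ ¬ R p.2.1 p.2.2} (fun p => f p.1 p.2.1 p.2.2)
    (Set.toFinite _) ⟨(s, i, j), hA, hn⟩
  have ih : ∀ s' i' j', A s' i' j' → f s i j < f s' i' j' → R i' j' := by
    intro s' i' j' hA' hlt
    by_contra hn'
    exact absurd (hmax (s', i', j') ⟨hA', hn'⟩) (not_le.2 hlt)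
  cases s
  · exact hn (reachable_step (X := X.swap) hR h2 h1 (by simpa [A] using hA)
      (fun i' j' h hlt => ih false i' j' h hlt) (fun i' j' h hlt => ih true i' j' h hlt))
  · exact hn (reachable_step (X := X) hR h1 h2 (by simpa [A] using hA)
      (fun i' j' h hlt => ih true i' j' h hlt) (fun i' j' h hlt => ih false i' j' h hlt))

variable (X) in
/-- Any two rectangles are joined by a chain of rectangles that touch along sides. -/
def Connected : Prop :=
  ∀ R : ι → ι → Prop, Equivalence R → (∀ i j, X.Adj (i, true) (j, false) → R i j) →
    (∀ i j, X.swap.Adj (i, true) (j, false) → R i j) → ∀ i j, R i j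

/-- The terminal contacts contain the edges of a connected graph on the rectangles, and such a graph
has at most one vertex more than edges. -/
theorem card_le_terminal [Finite ι] (hX : X.Connected) :
    Nat.card ι ≤ {p : ι × ι | X.Terminal p.1 p.2}.ncard
      + {p : ι × ι | X.swap.Terminal p.1 p.2}.ncard + 1 := by
  classical
  rcases isEmpty_or_nonempty ι with hι | hι
  · simp
  let G : SimpleGraph ι := SimpleGraph.fromRel fun i j => X.Terminal i j ∨ X.swap.Terminal i j
  have hreach : ∀ i j, X.Terminal i j ∨ X.swap.Terminal i j → G.Reachable i j := by
    intro i j h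
    by_cases hij : i = j
    · subst hij; rfl
    · exact SimpleGraph.Adj.reachable (by simp [G, SimpleGraph.fromRel_adj, hij, h])
  have hE : Equivalence G.Reachable :=
    ⟨fun i => SimpleGraph.Reachable.refl i, fun h => h.symm, fun h h' => h.trans h'⟩
  obtain ⟨h1, h2⟩ := reachable_of_adj hE (fun i j h => hreach i j (Or.inl h))
    (fun i j h => hreach i j (Or.inr h))
  have hG : G.Connected := ⟨fun i j => hX _ hE h1 h2 i j⟩
  refine hG.card_vert_le_card_edgeSet_add_one.trans ?_
  gcongr
  refine le_trans ?_ (Set.ncard_union_le _ _)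
  refine le_trans ?_ (Set.ncard_image_le (f := fun p : ι × ι => s(p.1, p.2)) (Set.toFinite _))
  rw [Nat.card_coe_set_eq]
  refine Set.ncard_le_ncard ?_ (Set.toFinite _)
  intro e
  induction e with
  | _ i j =>
    rw [SimpleGraph.mem_edgeSet, SimpleGraph.fromRel_adj]
    rintro ⟨-, h | h⟩
    · exact ⟨(i, j), h, rfl⟩
    · exact ⟨(j, i), h, Sym2.eq_swap⟩

/-! ### Counting terminal contacts -/

variable (X) in
/-- The points where a side goes on to the right beyond the material on its other side. -/
def eGapPoints : Set (ℝ × ℝ) := {p | ∃ n n', X.EGap n n' ∧ p = (X.r n'.1, X.height n)}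

variable (X) in
/-- The points where a side goes on to the left beyond the material on its other side. -/
def wGapPoints : Set (ℝ × ℝ) := {p | ∃ n n', X.WGap n n' ∧ p = (X.l n'.1, X.height n)}

theorem finite_eGapPoints [Finite ι] : X.eGapPoints.Finite :=
  (Set.finite_range fun q : (ι × Bool) × (ι × Bool) => (X.r q.2.1, X.height q.1)).subset
    fun _ ⟨n, n', _, h⟩ => ⟨(n, n'), h.symm⟩

theorem finite_wGapPoints [Finite ι] : X.wGapPoints.Finite :=
  (Set.finite_range fun q : (ι × Bool) × (ι × Bool) => (X.l q.2.1, X.height q.1)).subset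
    fun _ ⟨n, n', _, h⟩ => ⟨(n, n'), h.symm⟩

theorem disjoint_gapPoints : Disjoint X.eGapPoints X.wGapPoints := by
  rw [Set.disjoint_left]
  rintro p ⟨n, n', ⟨ha, hlt, hg⟩, rfl⟩ ⟨u, u', ⟨hau, hltu, hgu⟩, he⟩
  obtain ⟨he1, he2⟩ := Prod.ext_iff.1 he
  simp only at he1 he2
  have e1 := hau.2.2.2
  have e2 := ha.2.2.1
  have ho : X.Overlap n.1 u.1 := ⟨by linarith, by linarith⟩
  by_cases hs : n.2 = u.2
  · have := eq_of_overlap hs he2 ho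
    subst this
    linarith [hg u' hau he1.ge, X.l_lt_r u'.1]
  · have hs' : u.2 = n'.2 := by rw [ha.1]; revert hs; cases u.2 <;> cases n.2 <;> simp
    have e3 := X.l_lt_r n'.1
    have := eq_of_overlap hs' (he2.symm.trans ha.2.1) ⟨by linarith, by linarith⟩
    subst this
    linarith

theorem flush_seg_injOn : Set.InjOn (fun p : ι × ι => X.seg (p.1, true))
    {p | X.Adj (p.1, true) (p.2, false) ∧ X.r p.1 = X.r p.2} := by
  rintro ⟨i, j⟩ ⟨h1, h2⟩ ⟨i', j'⟩ ⟨h1', h2'⟩ h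
  obtain ⟨e1, e2⟩ := flush_unique h1 h2 h1' h2' rfl h
  simp only [Prod.mk.injEq, and_true] at e1 e2
  rw [e1, e2]

/-- A terminal contact that ends at a gap is charged to that gap, which faces east. A flush one is
the only one in its segment and is charged to the segment if that is free; otherwise the segment has
a west gap by `exists_wGap_of_flush`, and this takes the charge. -/
theorem ncard_terminal_le [Finite ι] : {p : ι × ι | X.Terminal p.1 p.2}.ncard ≤
    {κ | X.Free κ}.ncard + (X.eGapPoints ∪ X.wGapPoints).ncard := by
  classical
  rw [Set.ncard_union_eq disjoint_gapPoints finite_eGapPoints finite_wGapPoints]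
  have hsub : {p : ι × ι | X.Terminal p.1 p.2} ⊆
      {p | X.Adj (p.1, true) (p.2, false) ∧ X.r p.1 = X.r p.2} ∪
        {p | X.EGap (p.1, true) (p.2, false) ∨ X.EGap (p.2, false) (p.1, true)} := by
    rintro ⟨i, j⟩ ⟨h1, h2 | h2⟩
    · exact Or.inl ⟨h1, h2⟩
    · exact Or.inr h2
  have hflush : {p : ι × ι | X.Adj (p.1, true) (p.2, false) ∧ X.r p.1 = X.r p.2}.ncard ≤
      {κ | X.Free κ}.ncard + X.wGapPoints.ncard := by
    rw [← flush_seg_injOn.ncard_image]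
    have himg : (fun p : ι × ι => X.seg (p.1, true)) ''
        {p | X.Adj (p.1, true) (p.2, false) ∧ X.r p.1 = X.r p.2} ⊆
        {κ | X.Free κ} ∪ {κ | ∃ n n', X.WGap n n' ∧ X.seg n = κ} := by
      rintro _ ⟨⟨i, j⟩, ⟨h1, h2⟩, rfl⟩
      by_cases hW : ∃ n n', X.WGap n n' ∧ X.seg n = X.seg (i, true)
      · exact Or.inr hW
      · refine Or.inl ⟨⟨_, _, rfl, h1⟩, fun n n' hn =>
          ⟨fun hE => hW ?_, fun hg => hW ⟨n, n', hg, hn⟩⟩⟩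
        exact exists_wGap_of_flush h1 h2 hE hn
    refine (Set.ncard_le_ncard himg (Set.toFinite _)).trans ((Set.ncard_union_le _ _).trans ?_)
    gcongr
    have hch : ∀ κ : Quotient X.segSetoid, ∃ p : ℝ × ℝ,
        κ ∈ {κ | ∃ n n', X.WGap n n' ∧ X.seg n = κ} →
          ∃ n n', X.WGap n n' ∧ X.seg n = κ ∧ p = (X.l n'.1, X.height n) := by
      intro κ
      by_cases h : κ ∈ {κ | ∃ n n', X.WGap n n' ∧ X.seg n = κ}
      · obtain ⟨n, n', h1, h2⟩ := h
        exact ⟨_, fun _ => ⟨n, n', h1, h2, rfl⟩⟩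
      · exact ⟨0, fun h' => absurd h' h⟩
    choose f hf using hch
    refine Set.ncard_le_ncard_of_injOn f (fun κ hκ => ?_) ?_ finite_wGapPoints
    · obtain ⟨n, n', h1, -, h3⟩ := hf κ hκ
      exact ⟨n, n', h1, h3⟩
    -- A west gap determines its segment: sides that pass over the same point at the same height are
    -- equal or adjacent.
    · intro κ hκ κ' hκ' he
      obtain ⟨n, n', h1, h2, h3⟩ := hf κ hκ
      obtain ⟨u, u', h1', h2', h3'⟩ := hf κ' hκ'
      rw [h3, h3'] at he
      obtain ⟨he1, he2⟩ := Prod.ext_iff.1 he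
      simp only at he1 he2
      have ho : X.Overlap n.1 u.1 := ⟨by linarith [h1.2.1, h1'.1.2.2.2], by
        linarith [h1'.2.1, h1.1.2.2.2]⟩
      rw [← h2, ← h2']
      by_cases hs : n.2 = u.2
      · rw [eq_of_overlap hs he2 ho]
      · refine Adj.seg_eq ⟨?_, he2, ho⟩
        revert hs; cases u.2 <;> cases n.2 <;> simp
  have hgap : {p : ι × ι | X.EGap (p.1, true) (p.2, false) ∨
      X.EGap (p.2, false) (p.1, true)}.ncard ≤ X.eGapPoints.ncard := by
    refine Set.ncard_le_ncard_of_injOn (fun p => (min (X.r p.1) (X.r p.2), X.t p.1)) ?_ ?_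
      finite_eGapPoints
    · rintro ⟨i, j⟩ (h | h)
      · exact ⟨_, _, h, by simp [height, min_eq_right h.2.1.le]⟩
      · have := h.1.2.1
        simp only [height] at this
        exact ⟨_, _, h, by simp [height, min_eq_left h.2.1.le]; simpa using this.symm⟩
    · rintro ⟨i, j⟩ h ⟨i', j'⟩ h' he
      have h1 : X.Adj (i, true) (j, false) := h.elim (fun h => h.1) (fun h => h.1.symm)
      have h1' : X.Adj (i', true) (j', false) := h'.elim (fun h => h.1) (fun h => h.1.symm)
      obtain ⟨he1, he2⟩ := Prod.ext_iff.1 he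
      simp only at he1 he2
      have a1 := X.l_lt_r i
      have a2 := X.l_lt_r i'
      have a3 := X.l_lt_r j
      have a4 := X.l_lt_r j'
      obtain ⟨a5, a6⟩ := h1.2.2
      obtain ⟨a7, a8⟩ := h1'.2.2
      simp only at a5 a6 a7 a8
      have b1 := lt_min a1 a5
      have b2 := lt_min a6 a3
      have b3 := lt_min a2 a7
      have b4 := lt_min a8 a4
      have c1 := min_le_left (X.r i) (X.r j)
      have c2 := min_le_right (X.r i) (X.r j)
      have c3 := min_le_left (X.r i') (X.r j')
      have c4 := min_le_right (X.r i') (X.r j')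
      have e1 := eq_of_overlap (X := X) (n := (i, true)) (n' := (i', true)) rfl he2
        ⟨by simp only; linarith, by simp only; linarith⟩
      have e2 := eq_of_overlap (X := X) (n := (j, false)) (n' := (j', false)) rfl
        (h1.2.1.symm.trans (Eq.trans he2 h1'.2.1)) ⟨by simp only; linarith, by simp only; linarith⟩
      simp only [Prod.mk.injEq, and_true] at e1 e2
      rw [e1, e2]
  calc _ ≤ _ := Set.ncard_le_ncard hsub (Set.toFinite _)
    _ ≤ _ := Set.ncard_union_le _ _
    _ ≤ _ := by omega

end Tiling

/-! ### Counting free segments by levels and stacks -/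

/-- Let every element of `F` be a value of both `f` and `g` on `P`. If `Q` is inherited from `f i`
by `g i`, then the `i` at which `Q` begins to hold are not needed to hit all of `F`. -/
theorem ncard_add_ncard_cross_le {ι α : Type*} [Finite ι] [Finite α] {P : Set ι} {f g : ι → α}
    {F : Set α} {Q : α → Prop} (hf : ∀ κ ∈ F, ∃ i ∈ P, f i = κ) (hg : ∀ κ ∈ F, ∃ i ∈ P, g i = κ)
    (hQ : ∀ i ∈ P, Q (f i) → Q (g i)) :
    F.ncard + {i | i ∈ P ∧ ¬ Q (f i) ∧ Q (g i)}.ncard ≤ P.ncard := by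
  classical
  -- An element with `Q` is hit through `f`, one without `Q` through `g`. Since `Q` passes from `f
  -- i` to `g i`, no `i` serves two elements, and none at which `Q` begins is used.
  have hch : ∀ κ : F, ∃ i, i ∈ P ∧ ((Q κ ∧ f i = κ) ∨ (¬ Q κ ∧ g i = κ)) := by
    rintro ⟨κ, hκ⟩
    by_cases h : Q κ
    · obtain ⟨i, hi, h'⟩ := hf κ hκ
      exact ⟨i, hi, Or.inl ⟨h, h'⟩⟩
    · obtain ⟨i, hi, h'⟩ := hg κ hκ
      exact ⟨i, hi, Or.inr ⟨h, h'⟩⟩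
  choose φ hφP hφ using hch
  have hinj : Function.Injective φ := by
    rintro ⟨κ, hκ⟩ ⟨κ', hκ'⟩ h
    have h1 := hφ ⟨κ, hκ⟩
    have h2 := hφ ⟨κ', hκ'⟩
    have h3 := hφP ⟨κ', hκ'⟩
    rw [h] at h1
    have h4 := hQ _ h3
    simp only [Subtype.mk.injEq]
    rcases h1 with ⟨h1, h1'⟩ | ⟨h1, h1'⟩ <;> rcases h2 with ⟨h2, h2'⟩ | ⟨h2, h2'⟩
    · exact h1'.symm.trans h2'
    · rw [h1', h2'] at h4; exact absurd (h4 h1) h2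
    · rw [h1', h2'] at h4; exact absurd (h4 h2) h1
    · exact h1'.symm.trans h2'
  have hF : F.ncard = (Set.range φ).ncard := by
    rw [← Set.image_univ, Set.ncard_image_of_injective _ hinj, Set.ncard_univ,
      Nat.card_coe_set_eq]
  have hdisj : Disjoint (Set.range φ) {i | i ∈ P ∧ ¬ Q (f i) ∧ Q (g i)} := by
    rw [Set.disjoint_left]
    rintro _ ⟨κ, rfl⟩ ⟨-, h1, h2⟩
    rcases hφ κ with ⟨h, h'⟩ | ⟨h, h'⟩
    · rw [h'] at h1; exact h1 h
    · rw [h'] at h2; exact h h2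
  rw [hF, ← Set.ncard_union_eq hdisj]
  refine Set.ncard_le_ncard (Set.union_subset ?_ fun i hi => hi.1)
  rintro _ ⟨κ, rfl⟩
  exact hφP κ

namespace Tiling

variable {ι : Type*} {X : Tiling ι}

variable (X) in
/-- `κ` is the top of a chain of `k` rectangles in `P`, each standing on the segment at the top of
the previous one. -/
def IsTop (P : Set ι) : ℕ → Quotient X.segSetoid → Prop
  | 0, _ => True
  | k + 1, κ => ∃ i ∈ P, X.seg (i, true) = κ ∧ IsTop P k (X.seg (i, false))

theorem IsTop.pred {P : Set ι} {k : ℕ} {κ : Quotient X.segSetoid} (h : X.IsTop P (k + 1) κ) :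
    X.IsTop P k κ := by
  induction k generalizing κ with
  | zero => trivial
  | succ k ih =>
    obtain ⟨i, hi, h1, h2⟩ := h
    exact ⟨i, hi, h1, ih h2⟩

variable (X) in
/-- A chain of `k + 1` rectangles, each standing on the segment at the top of the previous one. -/
def IsStack (ρ : ℕ → ι) (k : ℕ) : Prop :=
  ∀ i < k, X.seg (ρ i, true) = X.seg (ρ (i + 1), false)

theorem IsTop.exists_stack {P : Set ι} {k : ℕ} {κ : Quotient X.segSetoid}
    (h : X.IsTop P (k + 1) κ) :
    ∃ ρ : ℕ → ι, (∀ i ≤ k, ρ i ∈ P) ∧ X.IsStack ρ k ∧ X.seg (ρ k, true) = κ := by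
  induction k generalizing κ with
  | zero =>
    obtain ⟨i, hi, h1, -⟩ := h
    exact ⟨fun _ => i, fun _ _ => hi, fun j hj => absurd hj (by omega), h1⟩
  | succ k ih =>
    obtain ⟨i, hi, h1, h2⟩ := h
    obtain ⟨ρ, h3, h4, h5⟩ := ih h2
    refine ⟨fun n => if n ≤ k then ρ n else i, fun j hj => ?_, fun j hj => ?_, ?_⟩
    · simp only
      split_ifs with hjk
      · exact h3 j hjk
      · exact hi
    · rcases Nat.lt_succ_iff_lt_or_eq.1 hj with hlt | rfl
      · simp only [hlt.le, Nat.succ_le_of_lt hlt, if_true]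
        exact h4 j hlt
      · simpa using h5
    · simpa using h1

theorem IsStack.t_eq {ρ : ℕ → ι} {k : ℕ} (h : X.IsStack ρ k) {i : ℕ} (hi : i < k) :
    X.t (ρ i) = X.b (ρ (i + 1)) := by
  simpa [height] using height_eq_of_seg_eq (h i hi)

theorem IsStack.t_le {ρ : ℕ → ι} {k : ℕ} (h : X.IsStack ρ k) {i j : ℕ} (hij : i < j) (hj : j ≤ k) :
    X.t (ρ i) ≤ X.b (ρ j) := by
  induction j, hij using Nat.le_induction with
  | base => exact (h.t_eq (by omega)).le
  | succ j hij ih =>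
    have := X.b_lt_t (ρ j)
    linarith [ih (by omega), h.t_eq (i := j) (by omega)]

theorem IsStack.injOn {ρ : ℕ → ι} {k : ℕ} (h : X.IsStack ρ k) : Set.InjOn ρ (Set.Iic k) := by
  intro i hi j hj hij
  have := X.b_lt_t (ρ i)
  rcases lt_trichotomy i j with hlt | heq | hlt
  · have h1 := h.t_le hlt hj
    rw [← hij] at h1; linarith
  · exact heq
  · have h1 := h.t_le hlt hi
    rw [← hij] at h1; linarith

theorem ncard_image_stack {ρ : ℕ → ι} {k : ℕ} (h : X.IsStack ρ k) :
    (ρ '' Set.Iic k).ncard = k + 1 := by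
  rw [h.injOn.ncard_image, Set.ncard_eq_toFinset_card']
  simp

/-- The rectangle `d` meets the horizontal strip of the `j`-th rectangle of the stack `ρ`. The first
and the last strip are unbounded. -/
def MeetsStrip (X : Tiling ι) (ρ : ℕ → ι) (k : ℕ) (d : ι) (j : ℕ) : Prop :=
  j ≤ k ∧ (j = k ∨ X.b d < X.t (ρ j)) ∧ (j = 0 ∨ X.b (ρ j) < X.t d)

/-- The left or right side `n` lies to the right of the stack `ρ`. -/
def RightOfStack (X : Tiling ι) (ρ : ℕ → ι) (k : ℕ) (n : ι × Bool) : Prop :=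
  ∀ j, X.MeetsStrip ρ k n.1 j → X.r (ρ j) ≤ X.swap.height n

/-- A rectangle that extends above and below a segment lies to its left or to its right. -/
theorem sep_of_cross {u : ι × Bool} {d : ι} (hb : X.b d < X.height u) (ht : X.height u < X.t d) :
    X.r u.1 ≤ X.l d ∨ X.r d ≤ X.l u.1 := by
  by_contra! hno
  obtain ⟨h1, h2⟩ := hno
  obtain ⟨i, s⟩ := u
  have hid : i ≠ d := by
    rintro rfl
    cases s <;> simp [height] at hb ht
  have := X.b_lt_t i
  have ho : X.Overlap i d := ⟨h2, h1⟩
  cases s <;> simp only [height] at hb ht <;> simp at hb ht <;> rcases ho.sep hid with h | h <;>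
    linarith

/-- Every side of the segment avoids `d`, and consecutive sides overlap, so a walk along the segment
cannot jump over `d`. -/
theorem r_le_iff_of_cross {u v : ι × Bool} {d : ι} (hb : X.b d < X.height u)
    (ht : X.height u < X.t d) (huv : X.seg u = X.seg v) :
    X.r u.1 ≤ X.l d ↔ X.r v.1 ≤ X.l d := by
  have key : ∀ u v : ι × Bool, X.b d < X.height u → X.height u < X.t d → X.seg u = X.seg v →
      X.r u.1 ≤ X.l d → X.r v.1 ≤ X.l d := by
    intro u v hb ht huv h
    refine seg_induction huv (fun w => X.r w.1 ≤ X.l d) h fun w z hw hwz hle => ?_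
    have hz : X.height z = X.height u := height_eq_of_seg_eq (hwz.seg_eq.symm.trans hw)
    rcases sep_of_cross (u := z) (d := d) (by rw [hz]; exact hb) (by rw [hz]; exact ht) with h | h
    · exact h
    · have := hwz.2.2.2
      linarith [X.l_lt_r d]
  have e := height_eq_of_seg_eq huv
  exact ⟨key u v hb ht huv, key v u (e ▸ hb) (e ▸ ht) huv.symm⟩

/-- Since `n.1` crosses the height of `u`, it lies entirely on one side of `u`, so testing its left
or its right side gives the same answer. -/
theorem r_le_height_iff {u n : ι × Bool} (hb : X.b n.1 < X.height u) (ht : X.height u < X.t n.1) :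
    X.r u.1 ≤ X.swap.height n ↔ X.r u.1 ≤ X.l n.1 := by
  obtain ⟨d, s⟩ := n
  have h1 := X.l_lt_r d
  have h2 := X.l_lt_r u.1
  cases s
  · simp [height, swap]
  · simp only [height, swap, if_true]
    constructor
    · intro h
      rcases sep_of_cross hb ht with h' | h'
      · exact h'
      · simp only at h'; linarith
    · intro h; linarith

/-- A rectangle that meets both strips crosses the segment between them, which contains the top of
`ρ j` and the bottom of `ρ (j + 1)`. -/
theorem IsStack.r_le_succ_iff {ρ : ℕ → ι} {k : ℕ} (h : X.IsStack ρ k) {n : ι × Bool} {j : ℕ}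
    (h1 : X.MeetsStrip ρ k n.1 j) (h2 : X.MeetsStrip ρ k n.1 (j + 1)) :
    X.r (ρ j) ≤ X.swap.height n ↔ X.r (ρ (j + 1)) ≤ X.swap.height n := by
  have hj : j < k := h2.1
  have e := h.t_eq hj
  have hb : X.b n.1 < X.t (ρ j) := h1.2.1.resolve_left (by omega)
  have ht : X.t (ρ j) < X.t n.1 := e ▸ h2.2.2.resolve_left (by omega)
  have a1 := r_le_height_iff (X := X) (u := (ρ j, true)) (n := n) (by simpa [height])
    (by simpa [height])
  have a2 := r_le_height_iff (X := X) (u := (ρ (j + 1), false)) (n := n) (by simpa [height, ← e])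
    (by simpa [height, ← e])
  have a3 := r_le_iff_of_cross (X := X) (u := (ρ j, true)) (d := n.1) (by simpa [height])
    (by simpa [height]) (h j hj)
  exact a1.trans (a3.trans a2.symm)

theorem IsStack.meetsStrip {ρ : ℕ → ι} {k : ℕ} (h : X.IsStack ρ k) {d : ι} {i j j' : ℕ}
    (h1 : X.MeetsStrip ρ k d j) (h2 : X.MeetsStrip ρ k d j') (hi : j ≤ i) (hi' : i ≤ j') :
    X.MeetsStrip ρ k d i := by
  have hk := h2.1
  refine ⟨by omega, ?_, ?_⟩
  · rcases h1.2.1 with hjk | hb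
    · left; omega
    · rcases hi.eq_or_lt with rfl | hlt
      · exact Or.inr hb
      · exact Or.inr (by linarith [h.t_le hlt (by omega), X.b_lt_t (ρ i)])
  · rcases h2.2.2 with hjk | hb
    · left; omega
    · rcases hi'.eq_or_lt with rfl | hlt
      · exact Or.inr hb
      · exact Or.inr (by linarith [h.t_le hlt (by omega), X.b_lt_t (ρ i)])

theorem IsStack.r_le_iff {ρ : ℕ → ι} {k : ℕ} (h : X.IsStack ρ k) {n : ι × Bool} {j j' : ℕ}
    (h1 : X.MeetsStrip ρ k n.1 j) (h2 : X.MeetsStrip ρ k n.1 j') :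
    X.r (ρ j) ≤ X.swap.height n ↔ X.r (ρ j') ≤ X.swap.height n := by
  wlog hjj : j ≤ j' generalizing j j'
  · exact (this h2 h1 (by omega)).symm
  induction j', hjj using Nat.le_induction with
  | base => rfl
  | succ i hi ih =>
    have := h.meetsStrip h1 h2 hi (by omega)
    exact (ih this).trans (h.r_le_succ_iff this h2)

theorem IsStack.exists_meetsStrip {ρ : ℕ → ι} {k : ℕ} (h : X.IsStack ρ k) {d d' : ι}
    (ho : X.swap.Overlap d d') : ∃ j, X.MeetsStrip ρ k d j ∧ X.MeetsStrip ρ k d' j := by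
  classical
  obtain ⟨ho1, ho2⟩ := ho
  simp only [swap] at ho1 ho2
  have h1 := X.b_lt_t d
  have h2 := X.b_lt_t d'
  -- The common strip is the first one that reaches above the higher of the two bottoms.
  have hex : ∃ j, j = k ∨ max (X.b d) (X.b d') < X.t (ρ j) := ⟨k, Or.inl rfl⟩
  have hspec := Nat.find_spec hex
  have hmin : ∀ i < Nat.find hex, ¬ (i = k ∨ max (X.b d) (X.b d') < X.t (ρ i)) :=
    fun i hi => Nat.find_min hex hi
  have hle : Nat.find hex ≤ k := Nat.find_min' hex (Or.inl rfl)
  generalize Nat.find hex = j at *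
  have hlow : j = 0 ∨ X.b (ρ j) ≤ max (X.b d) (X.b d') := by
    rcases Nat.eq_zero_or_pos j with h0 | h0
    · exact Or.inl h0
    · have := hmin (j - 1) (by omega)
      push Not at this
      have e := h.t_eq (i := j - 1) (by omega)
      rw [show j - 1 + 1 = j by omega] at e
      exact Or.inr (e ▸ this.2)
  have m1 := max_lt h1 ho2
  have m2 := max_lt ho1 h2
  refine ⟨j, ⟨hle, hspec.imp id fun h => (le_max_left _ _).trans_lt h,
    hlow.imp id fun h => h.trans_lt m1⟩, ⟨hle, hspec.imp id fun h => (le_max_right _ _).trans_lt h,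
    hlow.imp id fun h => h.trans_lt m2⟩⟩

/-- Adjacent vertical sides have the same abscissa and meet a common strip, and by
`IsStack.r_le_iff` a single strip decides. So being right of the stack is a property of whole
vertical segments. -/
theorem IsStack.rightOf_of_adj {ρ : ℕ → ι} {k : ℕ} (h : X.IsStack ρ k) {n n' : ι × Bool}
    (ha : X.swap.Adj n n') (hn : X.RightOfStack ρ k n) : X.RightOfStack ρ k n' := by
  obtain ⟨j, h1, h2⟩ := h.exists_meetsStrip ha.2.2
  intro j' hj'
  rw [h.r_le_iff hj' h2, ← ha.2.1]
  exact hn j h1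

theorem IsStack.eq_of_meetsStrip {ρ : ℕ → ι} {k : ℕ} (h : X.IsStack ρ k) {i j : ℕ} (hi : i ≤ k)
    (hj : X.MeetsStrip ρ k (ρ i) j) : j = i := by
  obtain ⟨hjk, h1, h2⟩ := hj
  by_contra hne
  rcases lt_or_gt_of_ne hne with hlt | hlt
  · have := h1.resolve_left (by omega)
    linarith [h.t_le hlt hi]
  · have := h2.resolve_left (by omega)
    linarith [h.t_le hlt hjk]

/-- A stack of rectangles crosses from left to right between two parts of the vertical segments. -/
theorem IsStack.ncard_free_add_le [Finite ι] {P : Set ι} {ρ : ℕ → ι} {k : ℕ} (h : X.IsStack ρ k)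
    (hρ : ∀ i ≤ k, ρ i ∈ P) (hf : ∀ κ, X.swap.Free κ → ∃ i ∈ P, X.swap.seg (i, false) = κ)
    (hg : ∀ κ, X.swap.Free κ → ∃ i ∈ P, X.swap.seg (i, true) = κ) :
    {κ | X.swap.Free κ}.ncard + (k + 1) ≤ P.ncard := by
  let Q : Quotient X.swap.segSetoid → Prop := fun κ => ∃ n, X.swap.seg n = κ ∧ X.RightOfStack ρ k n
  have hQ : ∀ n, Q (X.swap.seg n) ↔ X.RightOfStack ρ k n := by
    intro n
    refine ⟨?_, fun h' => ⟨n, rfl, h'⟩⟩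
    rintro ⟨n', h1, h2⟩
    exact seg_induction h1 (X.RightOfStack ρ k) h2 fun u v _ ha hu => h.rightOf_of_adj ha hu
  have key := ncard_add_ncard_cross_le (F := {κ | X.swap.Free κ}) (Q := Q) hf hg (by
    intro i _ hi
    rw [hQ] at hi ⊢
    intro j hj
    have := hi j hj
    simp only [height, swap, Bool.false_eq_true, if_false, if_true] at this ⊢
    linarith [X.l_lt_r i])
  refine le_trans ?_ key
  gcongr
  rw [← ncard_image_stack h]
  refine Set.ncard_le_ncard ?_
  rintro _ ⟨i, hi, rfl⟩
  refine ⟨hρ i hi, ?_, ?_⟩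
  · rw [hQ]
    intro hr
    have := hr i ⟨hi, Or.inr (X.b_lt_t _), Or.inr (X.b_lt_t _)⟩
    simp only [height, swap, Bool.false_eq_true, if_false] at this
    linarith [X.l_lt_r (ρ i)]
  · rw [hQ]
    intro j hj
    rw [h.eq_of_meetsStrip hi hj]
    simp [height, swap]

/-- This is the level argument for a longest chain: `c` is its length and `a` the size of a largest
level. The chain is crossed from left to right by the property `RightOfStack`, the level from bottom
to top by the property `IsTop`. -/
theorem exists_ncard_free_add_le [Finite ι] {P : Set ι}
    (hf : ∀ κ, X.Free κ → ∃ i ∈ P, X.seg (i, false) = κ)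
    (hg : ∀ κ, X.Free κ → ∃ i ∈ P, X.seg (i, true) = κ)
    (hf' : ∀ κ, X.swap.Free κ → ∃ i ∈ P, X.swap.seg (i, false) = κ)
    (hg' : ∀ κ, X.swap.Free κ → ∃ i ∈ P, X.swap.seg (i, true) = κ) :
    ∃ a c : ℕ, P.ncard ≤ a * c ∧ {κ | X.Free κ}.ncard + a ≤ P.ncard ∧
      {κ | X.swap.Free κ}.ncard + c ≤ P.ncard := by
  classical
  rcases P.eq_empty_or_nonempty with rfl | ⟨i₀, hi₀⟩
  -- With `P` empty only `a = c = 0` is possible; the argument below needs a chain of at least one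
  -- rectangle.
  · have h1 : {κ | X.Free κ} = ∅ := by
      ext κ; simp only [Set.mem_ofPred_eq, Set.mem_empty_iff_false, iff_false]
      intro h; simpa using hf κ h
    have h2 : {κ | X.swap.Free κ} = ∅ := by
      ext κ; simp only [Set.mem_ofPred_eq, Set.mem_empty_iff_false, iff_false]
      intro h; simpa using hf' κ h
    exact ⟨0, 0, by simp, by simp [h1], by simp [h2]⟩
  let S : Set ℕ := {k | ∃ κ, X.IsTop P (k + 1) κ}
  have hS0 : 0 ∈ S := ⟨_, i₀, hi₀, rfl, trivial⟩
  have hSfin : S.Finite := by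
    refine (Set.finite_le_nat P.ncard).subset ?_
    rintro k ⟨κ, hk⟩
    obtain ⟨ρ, h1, h2, -⟩ := hk.exists_stack
    have := Set.ncard_le_ncard (s := ρ '' Set.Iic k) (t := P)
      (by rintro _ ⟨i, hi, rfl⟩; exact h1 i hi)
    rw [ncard_image_stack h2] at this
    simp only [Set.mem_ofPred_eq]
    omega
  obtain ⟨k, hkS, hmax⟩ := Set.exists_max_image S id hSfin ⟨0, hS0⟩
  obtain ⟨κ₀, hκ₀⟩ := hkS
  obtain ⟨ρ, h1, h2, -⟩ := hκ₀.exists_stack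
  let cross : ℕ → Set ι := fun j =>
    {i | i ∈ P ∧ ¬ X.IsTop P (j + 1) (X.seg (i, false)) ∧ X.IsTop P (j + 1) (X.seg (i, true))}
  -- The level of `i` is the first `j` for which the bottom of `i` is not the top of a chain of
  -- length `j + 1`; adding `i` to a chain of length `j` makes its top one.
  have hcover : P ⊆ ⋃ j ∈ Finset.range (k + 1), cross j := by
    intro i hi
    have hex : ∃ j, ¬ X.IsTop P (j + 1) (X.seg (i, false)) := by
      refine ⟨k + 1, fun h => ?_⟩
      have := hmax (k + 1) ⟨_, h⟩
      simp at this
    have hfind := Nat.find_spec hex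
    have hmin : ∀ j < Nat.find hex, X.IsTop P (j + 1) (X.seg (i, false)) := fun j hj => by
      simpa using Nat.find_min hex hj
    generalize Nat.find hex = j at *
    have htop : X.IsTop P (j + 1) (X.seg (i, true)) := by
      refine ⟨i, hi, rfl, ?_⟩
      rcases Nat.eq_zero_or_pos j with rfl | hj
      · trivial
      · have := hmin (j - 1) (by omega)
        rwa [show j - 1 + 1 = j by omega] at this
    have hjk : j ≤ k := hmax j ⟨_, htop⟩
    simp only [Set.mem_iUnion, Finset.mem_range]
    exact ⟨j, by omega, hi, hfind, htop⟩
  have hsum : P.ncard ≤ ∑ j ∈ Finset.range (k + 1), (cross j).ncard :=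
    (Set.ncard_le_ncard hcover (Set.toFinite _)).trans (Finset.set_ncard_biUnion_le _ _)
  obtain ⟨j, hj, hjmax⟩ := Finset.exists_max_image (Finset.range (k + 1)) (fun j => (cross j).ncard)
    ⟨0, by simp⟩
  refine ⟨(cross j).ncard, k + 1, ?_, ?_, h2.ncard_free_add_le h1 hf' hg'⟩
  · refine hsum.trans ((Finset.sum_le_card_nsmul _ _ _ hjmax).trans ?_)
    simp [mul_comm]
  · exact ncard_add_ncard_cross_le (F := {κ | X.Free κ}) (Q := X.IsTop P (j + 1)) hf hg
      (fun i hi h => IsTop.pred ⟨i, hi, rfl, h⟩)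

/-! ### Regions, reflections, and pushing a segment -/

variable (X) in
/-- The `i`-th rectangle of a tiling, as a set. -/
def rect (i : ι) : Set (ℝ × ℝ) := {q | (X.l i ≤ q.1 ∧ q.1 ≤ X.r i) ∧ X.b i ≤ q.2 ∧ q.2 ≤ X.t i}

variable (X) in
/-- The union of the rectangles of a tiling. -/
def region : Set (ℝ × ℝ) := ⋃ i, X.rect i

theorem mem_region {q : ℝ × ℝ} : q ∈ X.region ↔ ∃ i, q ∈ X.rect i := Set.mem_iUnion

theorem mem_rect_swap {i : ι} {q : ℝ × ℝ} : q ∈ X.swap.rect i ↔ q.swap ∈ X.rect i := and_comm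

theorem mem_region_swap {q : ℝ × ℝ} : q ∈ X.swap.region ↔ q.swap ∈ X.region := by
  simp only [mem_region, mem_rect_swap]

variable (X) in
/-- The tiling reflected in the horizontal axis. -/
def flip : Tiling ι where
  l := X.l
  r := X.r
  b i := -X.t i
  t i := -X.b i
  l_lt_r := X.l_lt_r
  b_lt_t i := neg_lt_neg (X.b_lt_t i)
  sep i j h := by
    have := X.sep i j h
    simp only [neg_le_neg_iff]
    tauto

theorem mem_rect_flip {i : ι} {q : ℝ × ℝ} : q ∈ X.flip.rect i ↔ (q.1, -q.2) ∈ X.rect i := by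
  simp only [rect, flip, Set.mem_ofPred_eq]
  constructor <;> rintro ⟨h, h1, h2⟩ <;> exact ⟨h, by linarith, by linarith⟩

theorem mem_region_flip {q : ℝ × ℝ} : q ∈ X.flip.region ↔ (q.1, -q.2) ∈ X.region := by
  simp only [mem_region, mem_rect_flip]

/-- The tiling `X` is the tiling `Y` after some rectangles have been removed and those in `P`
have been enlarged. -/
def Improves (X : Tiling ι) (P : Set ι) : Prop :=
  ∃ (q : Set ι) (Y : Tiling q), P ⊆ q ∧ (∃ i, i ∉ q) ∧ Y.region = X.region ∧
    ∀ i : q, (i : ι) ∈ P → X.rect i ⊆ Y.rect i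

theorem Improves.of_swap {P : Set ι} (h : X.swap.Improves P) : X.Improves P := by
  obtain ⟨q, Y, h1, h2, h3, h4⟩ := h
  refine ⟨q, Y.swap, h1, h2, ?_, fun i hi p hp => ?_⟩
  · ext p
    rw [mem_region_swap, h3, mem_region_swap, Prod.swap_swap]
  · exact mem_rect_swap.2 (h4 i hi (mem_rect_swap.2 (by rwa [Prod.swap_swap])))

theorem Improves.of_flip {P : Set ι} (h : X.flip.Improves P) : X.Improves P := by
  obtain ⟨q, Y, h1, h2, h3, h4⟩ := h
  refine ⟨q, Y.flip, h1, h2, ?_, fun i hi p hp => ?_⟩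
  · ext p
    rw [mem_region_flip, h3, mem_region_flip]
    simp
  · exact mem_rect_flip.2 (h4 i hi (mem_rect_flip.2 (by simpa using hp)))

/-- `A` are the rectangles above and `B` those below a horizontal segment of height `y` that
they cover from both sides. -/
structure IsSegment (X : Tiling ι) (A B : Set ι) (y : ℝ) : Prop where
  nonempty : A.Nonempty
  b_eq : ∀ i ∈ A, X.b i = y
  t_eq : ∀ i ∈ B, X.t i = y
  mem_above : ∀ i ∈ B, ∀ j, X.b j = y → X.Overlap i j → j ∈ A
  mem_below : ∀ i ∈ A, ∀ j, X.t j = y → X.Overlap i j → j ∈ B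
  cover_above : ∀ i ∈ B, ∀ x, X.l i ≤ x → x ≤ X.r i → ∃ a ∈ A, X.l a ≤ x ∧ x ≤ X.r a
  cover_below : ∀ i ∈ A, ∀ x, X.l i ≤ x → x ≤ X.r i → ∃ a ∈ B, X.l a ≤ x ∧ x ≤ X.r a
  cover_above' : ∀ i ∈ B, ∀ x, X.l i ≤ x → x < X.r i → ∃ a ∈ A, X.l a ≤ x ∧ x < X.r a
  cover_below' : ∀ i ∈ A, ∀ x, X.l i ≤ x → x < X.r i → ∃ a ∈ B, X.l a ≤ x ∧ x < X.r a

theorem IsSegment.flip {A B : Set ι} {y : ℝ} (h : X.IsSegment A B y) (hB : B.Nonempty) :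
    X.flip.IsSegment B A (-y) where
  nonempty := hB
  b_eq i hi := by simp [Tiling.flip, h.t_eq i hi]
  t_eq i hi := by simp [Tiling.flip, h.b_eq i hi]
  mem_above i hi j hj ho := h.mem_below i hi j (by simpa [Tiling.flip] using hj) ho
  mem_below i hi j hj ho := h.mem_above i hi j (by simpa [Tiling.flip] using hj) ho
  cover_above := h.cover_below
  cover_below := h.cover_above
  cover_above' := h.cover_below'
  cover_below' := h.cover_above'

/-- If no rectangle above a segment has to be kept, the segment can be pushed upwards. -/
theorem IsSegment.improves [Finite ι] {A B P : Set ι} {y : ℝ} (h : X.IsSegment A B y)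
    (hP : ∀ i ∈ P, i ∉ A) : X.Improves P := by
  classical
  -- The segment is pushed up to the lowest top `y₁` above it; the rectangles of `A` with this top
  -- disappear, and `B` takes over the strip.
  obtain ⟨a₀, ha₀, hmin⟩ := Set.exists_min_image A X.t (Set.toFinite _) h.nonempty
  generalize hy₁ : X.t a₀ = y₁ at hmin
  have hy : y < y₁ := by rw [← hy₁, ← h.b_eq a₀ ha₀]; exact X.b_lt_t a₀
  have hAB : ∀ i ∈ A, i ∉ B := fun i hA hB => by
    have := X.b_lt_t i
    rw [h.b_eq i hA, h.t_eq i hB] at this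
    exact lt_irrefl _ this
  let b' : ι → ℝ := fun i => if i ∈ A then y₁ else X.b i
  let t' : ι → ℝ := fun i => if i ∈ B then y₁ else X.t i
  have hb' : ∀ i, X.b i ≤ b' i := fun i => by
    by_cases hi : i ∈ A
    · simp only [b', hi, if_true, h.b_eq i hi]; exact hy.le
    · simp [b', hi]
  have ht' : ∀ i, X.t i ≤ t' i := fun i => by
    by_cases hi : i ∈ B
    · simp only [t', hi, if_true, h.t_eq i hi]; exact hy.le
    · simp [t', hi]
  have hstack : ∀ i j, X.Overlap i j → i ≠ j → X.t i ≤ X.b j → t' i ≤ b' j := by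
    intro i j ho hij hle
    by_cases hi : i ∈ B
    · have hti := h.t_eq i hi
      by_cases hj : j ∈ A
      · simp [t', b', hi, hj]
      have hne : X.b j ≠ y := fun hbj => hj (h.mem_above i hi j hbj ho)
      have hlt : y < X.b j := lt_of_le_of_ne (hti ▸ hle) hne.symm
      -- Where `i` and `j` overlap, some `a` in `A` lies between them, so `j` starts no lower than
      -- `X.t a`, hence no lower than `y₁`.
      obtain ⟨a, ha, h1, h2⟩ := h.cover_above' i hi (max (X.l i) (X.l j)) (le_max_left _ _)
        (max_lt (X.l_lt_r i) ho.2)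
      have hoa : X.Overlap a j := ⟨h1.trans_lt (max_lt ho.1 (X.l_lt_r j)),
        (le_max_right _ _).trans_lt h2⟩
      have haj : a ≠ j := by rintro rfl; exact hj ha
      simp only [t', b', hi, hj, if_true, if_false]
      rcases hoa.sep haj with h3 | h3
      · exact (hmin a ha).trans h3
      · rw [h.b_eq a ha] at h3
        linarith [X.b_lt_t j]
    · have : t' i = X.t i := by simp [t', hi]
      rw [this]
      exact hle.trans (hb' j)
  let q : Set ι := {i | ¬ (i ∈ A ∧ X.t i = y₁)}
  let Y : Tiling q :=
    { l := fun i => X.l i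
      r := fun i => X.r i
      b := fun i => b' i
      t := fun i => t' i
      l_lt_r := fun i => X.l_lt_r i
      b_lt_t := by
        rintro ⟨i, hi⟩
        have := X.b_lt_t i
        by_cases hA : i ∈ A
        · simp only [b', t', hA, hAB i hA, if_true, if_false]
          exact lt_of_le_of_ne (hmin i hA) fun he => hi ⟨hA, he.symm⟩
        · simp only [b', hA, if_false]
          exact this.trans_le (ht' i)
      sep := by
        rintro ⟨i, hi⟩ ⟨j, hj⟩ hij
        have hij' : i ≠ j := fun h => hij (Subtype.ext h)
        simp only
        by_cases ho : X.Overlap i j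
        · rcases ho.sep hij' with h1 | h1
          · exact Or.inr (Or.inr (Or.inl (hstack i j ho hij' h1)))
          · exact Or.inr (Or.inr (Or.inr (hstack j i ho.symm hij'.symm h1)))
        · simp only [Overlap, not_and_or, not_lt] at ho
          tauto }
  refine ⟨q, Y, fun i hi hA => hP i hi hA.1, ⟨a₀, fun hn => hn ⟨ha₀, hy₁⟩⟩, ?_, ?_⟩
  · ext p
    rw [mem_region, mem_region]
    constructor
    · rintro ⟨⟨i, hi⟩, ⟨h1, h2⟩, h3, h4⟩
      simp only [Y] at h1 h2 h3 h4
      by_cases hB : i ∈ B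
      · by_cases hpy : p.2 ≤ y
        · exact ⟨i, ⟨h1, h2⟩, (hb' i).trans h3, by rw [h.t_eq i hB]; exact hpy⟩
        · obtain ⟨a, ha, h5, h6⟩ := h.cover_above i hB p.1 h1 h2
          simp only [t', hB, if_true] at h4
          refine ⟨a, ⟨h5, h6⟩, ?_, h4.trans (hmin a ha)⟩
          rw [h.b_eq a ha]; linarith
      · refine ⟨i, ⟨h1, h2⟩, (hb' i).trans h3, ?_⟩
        simpa [t', hB] using h4
    · rintro ⟨i, ⟨h1, h2⟩, h3, h4⟩
      by_cases hA : i ∈ A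
      · by_cases hpy : p.2 ≤ y₁
        · obtain ⟨j, hj, h5, h6⟩ := h.cover_below i hA p.1 h1 h2
          refine ⟨⟨j, fun hn => hAB j hn.1 hj⟩, ⟨h5, h6⟩, ?_, ?_⟩
          · have hjA : j ∉ A := fun hn => hAB j hn hj
            have := X.b_lt_t j
            simp only [Y, b', hjA, if_false]
            rw [h.t_eq j hj] at this
            rw [h.b_eq i hA] at h3
            linarith
          · simpa [Y, t', hj] using hpy
        · push Not at hpy
          refine ⟨⟨i, fun hn => absurd hn.2 (by linarith)⟩, ⟨h1, h2⟩, ?_, h4.trans (ht' i)⟩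
          simpa [Y, b', hA] using hpy.le
      · refine ⟨⟨i, fun hn => hA hn.1⟩, ⟨h1, h2⟩, ?_, h4.trans (ht' i)⟩
        simpa [Y, b', hA] using h3
  · rintro ⟨i, hi⟩ hiP p ⟨h1, h3, h4⟩
    refine ⟨h1, ?_, h4.trans (ht' i)⟩
    simpa [Y, b', hP i hiP] using h3

theorem Free.isSegment [Finite ι] {n : ι × Bool} (h : X.Free (X.seg n)) :
    X.IsSegment {i | X.seg (i, false) = X.seg n} {i | X.seg (i, true) = X.seg n} (X.height n) ∧
      {i | X.seg (i, true) = X.seg n}.Nonempty := by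
  obtain ⟨n', ha⟩ := h.exists_adj
  have hn' := ha.seg_eq
  have hs := ha.1
  have hf : ∀ i s, X.seg (i, s) = X.seg n → X.Free (X.seg (i, s)) := fun i s hi => hi ▸ h
  have hmem : ∀ s, ∃ i, X.seg (i, s) = X.seg n := by
    intro s
    obtain ⟨i, s'⟩ := n
    obtain ⟨j, s''⟩ := n'
    by_cases hss : s = s'
    · exact ⟨i, by rw [hss]⟩
    · refine ⟨j, ?_⟩
      rw [hn', show s = s'' by simp only at hs; rw [hs]; revert hss; cases s <;> cases s' <;> simp]
  have hb : ∀ i, X.seg (i, false) = X.seg n → X.b i = X.height n := fun i hi => by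
    simpa [height] using height_eq_of_seg_eq hi
  have ht : ∀ i, X.seg (i, true) = X.seg n → X.t i = X.height n := fun i hi => by
    simpa [height] using height_eq_of_seg_eq hi
  refine ⟨⟨hmem false, hb, ht, ?_, ?_, ?_, ?_, ?_, ?_⟩, hmem true⟩
  · intro i hi j hj ho
    have : X.Adj (i, true) (j, false) := ⟨rfl, by simp [height, ht i hi, hj], ho⟩
    exact this.seg_eq.symm.trans hi
  · intro i hi j hj ho
    have : X.Adj (i, false) (j, true) := ⟨rfl, by simp [height, hb i hi, hj], ho⟩
    exact this.seg_eq.symm.trans hi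
  · intro i hi x h1 h2
    obtain ⟨⟨u, s⟩, hu, h3⟩ := (hf i _ hi).exists_cover_closed h1 h2
    obtain rfl : s = false := hu.1
    exact ⟨u, hu.seg_eq.symm.trans hi, h3⟩
  · intro i hi x h1 h2
    obtain ⟨⟨u, s⟩, hu, h3⟩ := (hf i _ hi).exists_cover_closed h1 h2
    obtain rfl : s = true := hu.1
    exact ⟨u, hu.seg_eq.symm.trans hi, h3⟩
  · intro i hi x h1 h2
    obtain ⟨⟨u, s⟩, hu, h3⟩ := (hf i _ hi).exists_cover h1 h2
    obtain rfl : s = false := hu.1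
    exact ⟨u, hu.seg_eq.symm.trans hi, h3⟩
  · intro i hi x h1 h2
    obtain ⟨⟨u, s⟩, hu, h3⟩ := (hf i _ hi).exists_cover h1 h2
    obtain rfl : s = true := hu.1
    exact ⟨u, hu.seg_eq.symm.trans hi, h3⟩

/-- In a tiling that cannot be improved, free segments bound rectangles to be kept on both sides. -/
theorem exists_mem_of_not_improves [Finite ι] {P : Set ι} (hX : ¬ X.Improves P)
    {κ : Quotient X.segSetoid} (h : X.Free κ) (s : Bool) : ∃ i ∈ P, X.seg (i, s) = κ := by
  induction κ using Quotient.inductionOn with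
  | _ n =>
    by_contra! hno
    obtain ⟨h1, h2⟩ := Free.isSegment (X := X) (n := n) h
    cases s
    · exact hX (h1.improves fun i hi hA => hno i hi hA)
    · exact hX (Improves.of_flip ((h1.flip h2).improves fun i hi hA => hno i hi hA))

end Tiling

/-! ### Local shape at a point: gaps are reflex vertices -/

open Filter Topology

/-- The interval `[lo, hi]` contains a piece to the right (`true`) or left (`false`) of `x`. -/
def HasGerm (σ : Bool) (lo hi x : ℝ) : Prop := if σ then lo ≤ x ∧ x < hi else lo < x ∧ x ≤ hi

/-- The sign of a direction. -/
def dirSign (σ : Bool) : ℝ := if σ then 1 else -1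

theorem dirSign_not (σ : Bool) : dirSign (!σ) = - dirSign σ := by cases σ <;> simp [dirSign]

theorem eventually_mem_iff_hasGerm (σ : Bool) (lo hi x : ℝ) :
    ∀ᶠ z in 𝓝 x, 0 < dirSign σ * (z - x) → (lo ≤ z ∧ z ≤ hi ↔ HasGerm σ lo hi x) := by
  cases σ <;> simp only [dirSign, HasGerm]
  · have h1 : ∀ᶠ z in 𝓝 x, lo < x → lo < z := by
      by_cases h : lo < x
      · exact (lt_mem_nhds h).mono fun _ h _ => h
      · exact .of_forall fun _ h' => absurd h' h
    have h2 : ∀ᶠ z in 𝓝 x, hi < x → hi < z := by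
      by_cases h : hi < x
      · exact (lt_mem_nhds h).mono fun _ h _ => h
      · exact .of_forall fun _ h' => absurd h' h
    filter_upwards [h1, h2] with z h1 h2 hz
    simp at hz ⊢
    constructor
    · rintro ⟨h3, h4⟩
      refine ⟨by linarith, ?_⟩
      by_contra! h5
      linarith [h2 h5]
    · rintro ⟨h3, h4⟩
      exact ⟨(h1 h3).le, by linarith⟩
  · have h1 : ∀ᶠ z in 𝓝 x, x < hi → z < hi := by
      by_cases h : x < hi
      · exact (gt_mem_nhds h).mono fun _ h _ => h
      · exact .of_forall fun _ h' => absurd h' h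
    have h2 : ∀ᶠ z in 𝓝 x, x < lo → z < lo := by
      by_cases h : x < lo
      · exact (gt_mem_nhds h).mono fun _ h _ => h
      · exact .of_forall fun _ h' => absurd h' h
    filter_upwards [h1, h2] with z h1 h2 hz
    simp at hz ⊢
    constructor
    · rintro ⟨h3, h4⟩
      refine ⟨?_, by linarith⟩
      by_contra! h5
      linarith [h2 h5]
    · rintro ⟨h3, h4⟩
      exact ⟨by linarith, (h1 h4).le⟩

theorem HasGerm.le {σ : Bool} {lo hi x : ℝ} (h : HasGerm σ lo hi x) : lo ≤ x ∧ x ≤ hi := by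
  cases σ <;> simp only [HasGerm] at h <;> simp at h
  · exact ⟨h.1.le, h.2⟩
  · exact ⟨h.1, h.2.le⟩

theorem HasGerm.eventually {σ : Bool} {lo hi x : ℝ} (h : HasGerm σ lo hi x) :
    ∀ᶠ z in 𝓝 x, 0 ≤ dirSign σ * (z - x) → lo ≤ z ∧ z ≤ hi := by
  filter_upwards [eventually_mem_iff_hasGerm σ lo hi x] with z hz hs
  rcases hs.lt_or_eq with hlt | heq
  · exact (hz hlt).2 h
  · have : z = x := by cases σ <;> simp [dirSign] at heq <;> linarith
    rw [this]
    exact h.le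

theorem exists_hasGerm {lo hi x : ℝ} (hlt : lo < hi) (h1 : lo ≤ x) (h2 : x ≤ hi) :
    ∃ σ, HasGerm σ lo hi x := by
  rcases h2.lt_or_eq with h | h
  · exact ⟨true, h1, h⟩
  · exact ⟨false, by rw [h]; exact hlt, h2⟩

theorem HasGerm.lt {σ : Bool} {lo hi lo' hi' x : ℝ} (h : HasGerm σ lo hi x)
    (h' : HasGerm σ lo' hi' x) : lo < hi' := by
  cases σ <;> simp only [HasGerm] at h h' <;> simp at h h' <;> linarith

namespace Tiling

variable {ι : Type*} {X : Tiling ι}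

/-- The `i`-th rectangle contains a neighbourhood of `p` in one of the four quadrants at `p`. -/
def CoversQuadrant (X : Tiling ι) (p : ℝ × ℝ) (σ τ : Bool) (i : ι) : Prop :=
  HasGerm σ (X.l i) (X.r i) p.1 ∧ HasGerm τ (X.b i) (X.t i) p.2

theorem eventually_mem_rect_iff [Finite ι] (p : ℝ × ℝ) (σ τ : Bool) :
    ∀ᶠ q in 𝓝 p, ∀ i, 0 < dirSign σ * (q.1 - p.1) → 0 < dirSign τ * (q.2 - p.2) →
      (q ∈ X.rect i ↔ X.CoversQuadrant p σ τ i) := by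
  rw [eventually_all]
  intro i
  filter_upwards [continuous_fst.continuousAt.eventually
    (eventually_mem_iff_hasGerm σ (X.l i) (X.r i) p.1), continuous_snd.continuousAt.eventually
    (eventually_mem_iff_hasGerm τ (X.b i) (X.t i) p.2)] with q h1 h2 h3 h4
  exact and_congr (h1 h3) (h2 h4)

theorem CoversQuadrant.eventually {p : ℝ × ℝ} {σ τ : Bool} {i : ι} (h : X.CoversQuadrant p σ τ i) :
    ∀ᶠ q in 𝓝 p, 0 ≤ dirSign σ * (q.1 - p.1) → 0 ≤ dirSign τ * (q.2 - p.2) → q ∈ X.region := by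
  filter_upwards [continuous_fst.continuousAt.eventually h.1.eventually,
    continuous_snd.continuousAt.eventually h.2.eventually] with q h1 h2 h3 h4
  exact mem_region.2 ⟨i, h1 h3, h2 h4⟩

theorem isReflexVertex_of_coversQuadrant [Finite ι] {p : ℝ × ℝ} {σ τ : Bool}
    (h1 : ∃ i, X.CoversQuadrant p (!σ) τ i) (h2 : ∃ i, X.CoversQuadrant p σ (!τ) i)
    (h3 : ∃ i, X.CoversQuadrant p (!σ) (!τ) i) (h4 : ∀ i, ¬ X.CoversQuadrant p σ τ i) :
    IsReflexVertex X.region p := by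
  obtain ⟨i₁, h1⟩ := h1
  obtain ⟨i₂, h2⟩ := h2
  obtain ⟨i₃, h3⟩ := h3
  have hs : ∀ σ, dirSign σ = 1 ∨ dirSign σ = -1 := fun σ => by cases σ <;> simp [dirSign]
  have hev : ∀ᶠ q in 𝓝 p, (q ∈ X.region ↔
      ¬ (0 < dirSign σ * (q.1 - p.1) ∧ 0 < dirSign τ * (q.2 - p.2))) := by
    filter_upwards [h1.eventually, h2.eventually, h3.eventually,
      eventually_mem_rect_iff (X := X) p σ τ] with q e1 e2 e3 e4
    simp only [dirSign_not] at e1 e2 e3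
    constructor
    · rintro hq ⟨h5, h6⟩
      obtain ⟨i, hi⟩ := mem_region.1 hq
      exact h4 i ((e4 i h5 h6).1 hi)
    · intro hq
      rcases le_or_gt (dirSign σ * (q.1 - p.1)) 0 with h5 | h5
      · rcases le_or_gt 0 (dirSign τ * (q.2 - p.2)) with h6 | h6
        · exact e1 (by linarith) h6
        · exact e3 (by linarith) (by linarith)
      · have h6 : dirSign τ * (q.2 - p.2) ≤ 0 := by
          by_contra! h6
          exact hq ⟨h5, h6⟩
        exact e2 h5.le (by linarith)
  obtain ⟨ε, hε, hb⟩ := Metric.eventually_nhds_iff.1 hev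
  refine ⟨_, _, hs σ, hs τ, ε, hε, fun q hq1 hq2 => hb ?_⟩
  rw [Prod.dist_eq, Real.dist_eq, Real.dist_eq]
  exact max_lt hq1 hq2

theorem hasGerm_height {n : ι × Bool} : HasGerm (!n.2) (X.b n.1) (X.t n.1) (X.height n) := by
  obtain ⟨i, s⟩ := n
  have := X.b_lt_t i
  cases s <;> simp [HasGerm, height, this]

theorem Adj.hasGerm_height {n n' : ι × Bool} (h : X.Adj n n') :
    HasGerm n.2 (X.b n'.1) (X.t n'.1) (X.height n) := by
  have := Tiling.hasGerm_height (X := X) (n := n')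
  rwa [h.1, Bool.not_not, ← h.2.1] at this

theorem adj_of_hasGerm {n : ι × Bool} {d : ι} (ho : X.Overlap n.1 d)
    (h : HasGerm n.2 (X.b d) (X.t d) (X.height n)) : X.Adj n (d, !n.2) :=
  adj_of_cover ho (fun hn => by simpa [HasGerm, hn] using h) fun hn => by
    simpa [HasGerm, hn] using h

/-- Of the four quadrants, `n` covers two and `n'` a third. A rectangle in the fourth would be
adjacent to `n` and continue past the end of `n'`, which a gap excludes. -/
theorem EGap.isReflexVertex [Finite ι] {n n' : ι × Bool} (h : X.EGap n n') :
    IsReflexVertex X.region (X.r n'.1, X.height n) := by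
  obtain ⟨ha, hlt, hg⟩ := h
  have hl := ha.2.2.1
  have hl' := X.l_lt_r n'.1
  refine isReflexVertex_of_coversQuadrant (σ := true) (τ := n.2) ⟨n'.1, ?_, ha.hasGerm_height⟩
    ⟨n.1, ?_, hasGerm_height⟩ ⟨n.1, ?_, hasGerm_height⟩ ?_
  · simp [HasGerm, hl']
  · simp [HasGerm, hlt, hl.le]
  · simp [HasGerm, hlt.le, hl]
  · rintro d ⟨⟨h1, h2⟩, h3⟩
    have := hg (d, !n.2) (adj_of_hasGerm ⟨hl.trans h2, lt_of_le_of_lt h1 hlt⟩ h3) h1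
    exact absurd h2 (not_lt.2 this)

theorem WGap.isReflexVertex [Finite ι] {n n' : ι × Bool} (h : X.WGap n n') :
    IsReflexVertex X.region (X.l n'.1, X.height n) := by
  obtain ⟨ha, hlt, hg⟩ := h
  have hl := ha.2.2.2
  have hl' := X.l_lt_r n'.1
  refine isReflexVertex_of_coversQuadrant (σ := false) (τ := n.2) ⟨n'.1, ?_, ha.hasGerm_height⟩
    ⟨n.1, ?_, hasGerm_height⟩ ⟨n.1, ?_, hasGerm_height⟩ ?_
  · simp [HasGerm, hl']
  · simp [HasGerm, hlt, hl.le]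
  · simp [HasGerm, hlt.le, hl]
  · rintro d ⟨⟨h1, h2⟩, h3⟩
    have := hg (d, !n.2) (adj_of_hasGerm ⟨lt_of_lt_of_le hlt h2, lt_trans h1 hl⟩ h3) h2
    exact absurd h1 (not_lt.2 this)

theorem isReflexVertex_of_swap {p : ℝ × ℝ} (h : IsReflexVertex X.swap.region p) :
    IsReflexVertex X.region p.swap := by
  obtain ⟨s, t, hs, ht, ε, hε, h⟩ := h
  refine ⟨t, s, ht, hs, ε, hε, fun q h1 h2 => ?_⟩
  have := h q.swap h2 h1
  rw [mem_region_swap, Prod.swap_swap] at this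
  rw [this, and_comm]
  rfl

variable (X) in
/-- The reflex vertices that lie inside a horizontal side of a rectangle. -/
def gapPoints : Set (ℝ × ℝ) := X.eGapPoints ∪ X.wGapPoints

theorem finite_gapPoints [Finite ι] : X.gapPoints.Finite :=
  finite_eGapPoints.union finite_wGapPoints

theorem isReflexVertex_of_mem_gapPoints [Finite ι] {p : ℝ × ℝ} (h : p ∈ X.gapPoints) :
    IsReflexVertex X.region p := by
  rcases h with ⟨n, n', h, rfl⟩ | ⟨n, n', h, rfl⟩
  · exact h.isReflexVertex
  · exact h.isReflexVertex

theorem exists_side_of_mem_gapPoints {p : ℝ × ℝ} (h : p ∈ X.gapPoints) :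
    ∃ i, X.l i < p.1 ∧ p.1 < X.r i ∧ X.b i ≤ p.2 ∧ p.2 ≤ X.t i := by
  rcases h with ⟨n, n', ⟨h1, h2, -⟩, rfl⟩ | ⟨n, n', ⟨h1, h2, -⟩, rfl⟩
  · exact ⟨n.1, h1.2.2.1, h2, hasGerm_height.le⟩
  · exact ⟨n.1, h2, h1.2.2.2, hasGerm_height.le⟩

theorem exists_not_inside_of_mem_gapPoints {p : ℝ × ℝ} (h : p ∈ X.gapPoints) :
    ∀ i, ¬ ((X.l i < p.1 ∧ p.1 < X.r i) ∧ X.b i < p.2 ∧ p.2 < X.t i) := by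
  rcases h with ⟨n, n', ⟨h1, h2, -⟩, rfl⟩ | ⟨n, n', ⟨h1, h2, -⟩, rfl⟩
  · rintro i ⟨⟨h3, h4⟩, h5, h6⟩
    rcases sep_of_cross h5 h6 with h | h
    · linarith [h1.2.2.1]
    · linarith [h1.2.2.1]
  · rintro i ⟨⟨h3, h4⟩, h5, h6⟩
    rcases sep_of_cross h5 h6 with h | h
    · linarith [h1.2.2.2]
    · linarith [h1.2.2.2]

/-- Such a point would lie strictly inside a horizontal side and strictly inside a vertical one, so
two rectangles would overlap or the point would be interior to one. -/
theorem disjoint_gapPoints_swap : Disjoint X.gapPoints (Prod.swap '' X.swap.gapPoints) := by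
  rw [Set.disjoint_left]
  rintro _ hp ⟨p, hp', rfl⟩
  obtain ⟨i, h1, h2, h3, h4⟩ := exists_side_of_mem_gapPoints hp
  obtain ⟨j, h5, h6, h7, h8⟩ := exists_side_of_mem_gapPoints hp'
  simp only [swap, Prod.fst_swap, Prod.snd_swap] at *
  have hij : i ≠ j := by
    rintro rfl
    exact exists_not_inside_of_mem_gapPoints hp i ⟨⟨h1, h2⟩, h5, h6⟩
  rcases X.sep i j hij with h | h | h | h <;> linarith

/-- The gaps in horizontal and in vertical segments are distinct reflex vertices. -/
theorem ncard_gapPoints_le [Finite ι] {T : ℕ} (h : {p | IsReflexVertex X.region p}.encard = T) :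
    X.gapPoints.ncard + X.swap.gapPoints.ncard ≤ T := by
  have hfin : {p | IsReflexVertex X.region p}.Finite :=
    Set.finite_of_encard_eq_coe h
  rw [← Set.ncard_image_of_injective X.swap.gapPoints Prod.swap_injective,
    ← Set.ncard_union_eq disjoint_gapPoints_swap finite_gapPoints (finite_gapPoints.image _)]
  have hT : {p | IsReflexVertex X.region p}.ncard = T := by simp [Set.ncard, h]
  rw [← hT]
  refine Set.ncard_le_ncard (Set.union_subset ?_ ?_) hfin
  · exact fun p hp => isReflexVertex_of_mem_gapPoints hp
  · rintro _ ⟨p, hp, rfl⟩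
    exact isReflexVertex_of_swap (isReflexVertex_of_mem_gapPoints hp)

/-! ### Connected interior gives connected contacts -/

theorem isClosed_rect (i : ι) : IsClosed (X.rect i) := by
  have : X.rect i = Set.Icc (X.l i) (X.r i) ×ˢ Set.Icc (X.b i) (X.t i) := rfl
  rw [this]
  exact isClosed_Icc.prod isClosed_Icc

theorem exists_mem_interior (i : ι) : ∃ p ∈ X.rect i, p ∈ interior X.region := by
  have h1 := X.l_lt_r i
  have h2 := X.b_lt_t i
  have hsub : Set.Ioo (X.l i) (X.r i) ×ˢ Set.Ioo (X.b i) (X.t i) ⊆ X.rect i :=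
    fun q hq => ⟨⟨hq.1.1.le, hq.1.2.le⟩, hq.2.1.le, hq.2.2.le⟩
  have hmem : ((X.l i + X.r i) / 2, (X.b i + X.t i) / 2) ∈
      Set.Ioo (X.l i) (X.r i) ×ˢ Set.Ioo (X.b i) (X.t i) :=
    ⟨⟨by simp only; linarith, by simp only; linarith⟩, by simp only; linarith,
      by simp only; linarith⟩
  exact ⟨_, hsub hmem, mem_interior.2 ⟨_, fun q hq => mem_region.2 ⟨i, hsub hq⟩,
    isOpen_Ioo.prod isOpen_Ioo, hmem⟩⟩

theorem exists_coversQuadrant [Finite ι] {p : ℝ × ℝ} (hp : p ∈ interior X.region) (σ τ : Bool) :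
    ∃ i, X.CoversQuadrant p σ τ i := by
  have hev := (eventually_mem_rect_iff (X := X) p σ τ).and (mem_interior_iff_mem_nhds.1 hp)
  obtain ⟨ε, hε, hb⟩ := Metric.eventually_nhds_iff.1 hev
  have hs : ∀ σ, dirSign σ * dirSign σ = 1 := fun σ => by cases σ <;> simp [dirSign]
  have habs : ∀ σ, |dirSign σ| = 1 := fun σ => by cases σ <;> simp [dirSign]
  obtain ⟨h1, h2⟩ := hb (y := (p.1 + ε / 2 * dirSign σ, p.2 + ε / 2 * dirSign τ)) (by
    rw [Prod.dist_eq, Real.dist_eq, Real.dist_eq]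
    simp only [add_sub_cancel_left, abs_mul, habs, mul_one, max_self, abs_of_pos (half_pos hε)]
    exact half_lt_self hε)
  obtain ⟨i, hi⟩ := mem_region.1 h2
  refine ⟨i, (h1 i ?_ ?_).1 hi⟩
  · simp only [add_sub_cancel_left]
    have := hs σ
    nlinarith
  · simp only [add_sub_cancel_left]
    have := hs τ
    nlinarith

theorem CoversQuadrant.unique {p : ℝ × ℝ} {σ τ : Bool} {i j : ι} (hi : X.CoversQuadrant p σ τ i)
    (hj : X.CoversQuadrant p σ τ j) : i = j := by
  by_contra hij
  rcases X.sep i j hij with h | h | h | h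
  · exact absurd h (not_le.2 (hj.1.lt hi.1))
  · exact absurd h (not_le.2 (hi.1.lt hj.1))
  · exact absurd h (not_le.2 (hj.2.lt hi.2))
  · exact absurd h (not_le.2 (hi.2.lt hj.2))

theorem CoversQuadrant.swap_adj {p : ℝ × ℝ} {τ : Bool} {i j : ι}
    (hi : X.CoversQuadrant p false τ i) (hj : X.CoversQuadrant p true τ j) (hij : i ≠ j) :
    X.swap.Adj (i, true) (j, false) := by
  have ho : X.swap.Overlap i j := ⟨hi.2.lt hj.2, hj.2.lt hi.2⟩
  have h1 := hi.1.le
  have h2 := hj.1.le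
  have e1 := X.l_lt_r i
  have e2 := X.l_lt_r j
  refine ⟨rfl, ?_, ho⟩
  simp only [height, swap, Bool.false_eq_true, if_true, if_false]
  rcases ho.sep hij with h | h <;> simp only [swap] at h
  · linarith
  · have h3 := hi.1
    simp only [HasGerm, Bool.false_eq_true, if_false] at h3
    linarith

theorem CoversQuadrant.of_swap {p : ℝ × ℝ} {σ τ : Bool} {i : ι} (h : X.CoversQuadrant p σ τ i) :
    X.swap.CoversQuadrant p.swap τ σ i := ⟨h.2, h.1⟩

/-- Otherwise a class of rectangles and its complement have closed unions that share an interior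
point `p` of the region. The rectangles in neighbouring quadrants at `p` coincide or touch along a
side, so all rectangles through `p` are in one class. -/
theorem connected_of_isPreconnected_interior [Finite ι] (h : IsPreconnected (interior X.region)) :
    X.Connected := by
  intro R hR h1 h2 i₀ j₀
  by_contra hno
  rw [isPreconnected_closed_iff] at h
  obtain ⟨p, hpi, hp1, hp2⟩ := h (⋃ i ∈ {i | R i₀ i}, X.rect i) (⋃ i ∈ {i | ¬ R i₀ i}, X.rect i)
    ((Set.toFinite _).isClosed_biUnion fun i _ => isClosed_rect i)
    ((Set.toFinite _).isClosed_biUnion fun i _ => isClosed_rect i) (by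
      intro p hp
      obtain ⟨i, hi⟩ := mem_region.1 (interior_subset hp)
      by_cases hRi : R i₀ i
      · exact Or.inl (Set.mem_biUnion (x := i) hRi hi)
      · exact Or.inr (Set.mem_biUnion (x := i) hRi hi)) (by
      obtain ⟨p, hp, hpi⟩ := exists_mem_interior (X := X) i₀
      exact ⟨p, hpi, Set.mem_biUnion (x := i₀) (hR.refl _) hp⟩) (by
      obtain ⟨p, hp, hpi⟩ := exists_mem_interior (X := X) j₀
      exact ⟨p, hpi, Set.mem_biUnion (x := j₀) hno hp⟩)
  choose D hD using exists_coversQuadrant hpi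
  have hx : ∀ τ, R (D false τ) (D true τ) := by
    intro τ
    by_cases he : D false τ = D true τ
    · rw [he]; exact hR.refl _
    · exact h2 _ _ ((hD false τ).swap_adj (hD true τ) he)
  have hy : ∀ σ, R (D σ false) (D σ true) := by
    intro σ
    by_cases he : D σ false = D σ true
    · rw [he]; exact hR.refl _
    · exact h1 _ _ ((hD σ false).of_swap.swap_adj (hD σ true).of_swap he)
  have hall : ∀ σ τ, R (D false false) (D σ τ) := by
    intro σ τ
    cases σ <;> cases τ
    · exact hR.refl _
    · exact hy false
    · exact hx false
    · exact hR.trans (hx false) (hy true)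
  have hmem : ∀ i, p ∈ X.rect i → R (D false false) i := by
    rintro i ⟨⟨h3, h4⟩, h5, h6⟩
    obtain ⟨σ, hσ⟩ := exists_hasGerm (X.l_lt_r i) h3 h4
    obtain ⟨τ, hτ⟩ := exists_hasGerm (X.b_lt_t i) h5 h6
    rw [CoversQuadrant.unique (X := X) ⟨hσ, hτ⟩ (hD σ τ)]
    exact hall σ τ
  simp only [Set.mem_iUnion, Set.mem_ofPred_eq, exists_prop] at hp1 hp2
  obtain ⟨i, hi, hpi⟩ := hp1
  obtain ⟨j, hj, hpj⟩ := hp2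
  exact hj (hR.trans hi (hR.trans (hR.symm (hmem i hpi)) (hmem j hpj)))

end Tiling

/-! ### Existence of a tiling around the toppings -/

theorem exists_next_of_finset (F : Finset ℝ) (x : ℝ) :
    ∃ x', x < x' ∧ (∀ z ∈ F, x < z → x' ≤ z) ∧ ((∃ z ∈ F, x < z) → x' ∈ F) := by
  by_cases h : ∃ z ∈ F, x < z
  · obtain ⟨z, hz, hxz⟩ := h
    obtain ⟨x', hx', hmin⟩ := (F.filter (x < ·)).exists_min_image id ⟨z, by simp [hz, hxz]⟩
    rw [Finset.mem_filter] at hx'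
    exact ⟨x', hx'.2, fun z hz hxz => hmin z (by simp [hz, hxz]), fun _ => hx'.1⟩
  -- Nothing in `F` lies beyond `x`, so any larger value will do.
  · exact ⟨x + 1, by linarith, fun z hz hxz => absurd ⟨z, hz, hxz⟩ h, fun h' => absurd h' h⟩

theorem exists_grid_interval {F : Finset ℝ} {nx : ℝ → ℝ}
    (h : ∀ x, x < nx x ∧ (∀ z ∈ F, x < z → nx x ≤ z) ∧ ((∃ z ∈ F, x < z) → nx x ∈ F))
    {l r p : ℝ} (hl : l ∈ F) (hr : r ∈ F) (hlr : l < r) (h1 : l ≤ p) (h2 : p ≤ r) :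
    ∃ x ∈ F, (l ≤ x ∧ nx x ≤ r) ∧ x ≤ p ∧ p ≤ nx x := by
  obtain ⟨x, hx, hmax⟩ := (F.filter fun z => z ≤ p ∧ z < r).exists_max_image id
    ⟨l, by simp [hl, h1, hlr]⟩
  rw [Finset.mem_filter] at hx
  obtain ⟨hxF, hxp, hxr⟩ := hx
  obtain ⟨h3, h4, h5⟩ := h x
  refine ⟨x, hxF, ⟨hmax l (by simp [hl, h1, hlr]), h4 r hr hxr⟩, hxp, ?_⟩
  by_contra! hlt
  have := hmax (nx x) (by simp [h5 ⟨r, hr, hxr⟩, hlt.le, hlt.trans_le h2])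
  exact absurd h3 (not_lt.2 this)

theorem exists_coordinates {S : Set (Set (ℝ × ℝ))} (hS : S.Finite) (h : ∀ R ∈ S, IsAxisRect R) :
    ∃ F G : Finset ℝ, ∀ R ∈ S, ∃ a b : ℝ × ℝ, (a.1 ∈ F ∧ b.1 ∈ F) ∧ (a.2 ∈ G ∧ b.2 ∈ G) ∧
      a.1 < b.1 ∧ a.2 < b.2 ∧ R = Set.Icc a b := by
  classical
  induction S, hS using Set.Finite.induction_on with
  | empty => exact ⟨∅, ∅, by simp⟩
  | @insert R S _ _ ih =>
    obtain ⟨F, G, hFG⟩ := ih fun R hR => h R (Set.mem_insert_of_mem _ hR)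
    obtain ⟨a, b, h1, h2, h3⟩ := h R (Set.mem_insert _ _)
    refine ⟨insert a.1 (insert b.1 F), insert a.2 (insert b.2 G), ?_⟩
    rintro R' (rfl | hR')
    · exact ⟨a, b, by simp, by simp, h1, h2, h3⟩
    · obtain ⟨a', b', h4, h5, h6⟩ := hFG R' hR'
      exact ⟨a', b', by simp [h4], by simp [h5], h6⟩

theorem interior_Icc_eq_prod (a b : ℝ × ℝ) :
    interior (Set.Icc a b) = Set.Ioo a.1 b.1 ×ˢ Set.Ioo a.2 b.2 := by
  rw [Set.Icc_prod_eq, interior_prod_eq, interior_Icc, interior_Icc]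

theorem sep_of_disjoint_interior {a b a' b' : ℝ × ℝ} (h1 : a.1 < b.1) (h2 : a.2 < b.2)
    (h1' : a'.1 < b'.1) (h2' : a'.2 < b'.2)
    (h : Disjoint (interior (Set.Icc a b)) (interior (Set.Icc a' b'))) :
    b.1 ≤ a'.1 ∨ b'.1 ≤ a.1 ∨ b.2 ≤ a'.2 ∨ b'.2 ≤ a.2 := by
  rw [interior_Icc_eq_prod, interior_Icc_eq_prod] at h
  by_contra! hno
  obtain ⟨h3, h4, h5, h6⟩ := hno
  obtain ⟨x, hx1, hx2⟩ := exists_between (max_lt (lt_min h1 h4) (lt_min h3 h1'))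
  obtain ⟨y, hy1, hy2⟩ := exists_between (max_lt (lt_min h2 h6) (lt_min h5 h2'))
  simp only [max_lt_iff, lt_min_iff] at hx1 hx2 hy1 hy2
  exact Set.disjoint_left.1 h (show (x, y) ∈ _ from ⟨⟨hx1.1, hx2.1⟩, hy1.1, hy2.1⟩)
    ⟨⟨hx1.2, hx2.2⟩, hy1.2, hy2.2⟩

theorem Icc_subset_of_le {a b a' b' : ℝ × ℝ} (h1 : a.1 ≤ a'.1) (h2 : a.2 ≤ a'.2)
    (h3 : b'.1 ≤ b.1) (h4 : b'.2 ≤ b.2) : Set.Icc a' b' ⊆ Set.Icc a b :=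
  Set.Icc_subset_Icc ⟨h1, h2⟩ ⟨h3, h4⟩

namespace Tiling

theorem rect_eq_Icc {ι : Type*} (X : Tiling ι) (i : ι) :
    X.rect i = Set.Icc (X.l i, X.b i) (X.r i, X.t i) := by
  ext q
  simp only [rect, Set.mem_ofPred_eq, Set.mem_Icc, Prod.le_def]
  tauto

/-- There is a tiling of `C` by `n` rectangles in which the sets `Z i` are contained in different
rectangles. -/
def Realizable (C : Set (ℝ × ℝ)) {m : ℕ} (Z : Fin m → Set (ℝ × ℝ)) (n : ℕ) : Prop :=
  ∃ (ι : Type) (_ : Finite ι) (X : Tiling ι) (τ : Fin m → ι), Function.Injective τ ∧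
    X.region = C ∧ (∀ i, Z i ⊆ X.rect (τ i)) ∧ Nat.card ι = n

/-- The grid through all coordinates of the toppings and of the rectangles forming `C` cuts `C` into
cells. The toppings, together with the cells of `C` in no topping, form a tiling. -/
theorem exists_realizable {C : Set (ℝ × ℝ)} {m : ℕ} {Z : Fin m → Set (ℝ × ℝ)}
    (hC : ∃ S : Set (Set (ℝ × ℝ)), S.Finite ∧ (∀ R ∈ S, IsAxisRect R) ∧ C = ⋃₀ S)
    (hZ : ∀ i, IsAxisRect (Z i) ∧ Z i ⊆ C)
    (hdisj : ∀ i j, i ≠ j → Disjoint (interior (Z i)) (interior (Z j))) :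
    ∃ n, Realizable C Z n := by
  obtain ⟨S, hS, hSR, rfl⟩ := hC
  obtain ⟨F, G, hFG⟩ := exists_coordinates (S := S ∪ Set.range Z)
    (hS.union (Set.finite_range _)) (by
      rintro R (hR | ⟨i, rfl⟩)
      · exact hSR R hR
      · exact (hZ i).1)
  choose a b haF haG hab1 hab2 hZab using fun i => hFG (Z i) (Or.inr ⟨i, rfl⟩)
  choose nx hnx using exists_next_of_finset F
  choose ny hny using exists_next_of_finset G
  let cell : ℝ × ℝ → Set (ℝ × ℝ) := fun c => Set.Icc c (nx c.1, ny c.2)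
  let K : Set (ℝ × ℝ) := {c | (c.1 ∈ F ∧ c.2 ∈ G) ∧ (∃ R ∈ S, cell c ⊆ R) ∧ ∀ i, ¬ cell c ⊆ Z i}
  have hK : K.Finite := (F.finite_toSet.prod G.finite_toSet).subset fun c hc => hc.1
  have : Finite K := hK
  -- No grid line runs through the interior of a cell, so a cell overlapping a topping would be
  -- contained in it.
  have key : ∀ i (c : K), (b i).1 ≤ c.1.1 ∨ nx c.1.1 ≤ (a i).1 ∨ (b i).2 ≤ c.1.2 ∨
      ny c.1.2 ≤ (a i).2 := by
    rintro i ⟨c, hc⟩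
    by_contra! hno
    obtain ⟨h1, h2, h3, h4⟩ := hno
    refine hc.2.2 i ?_
    rw [hZab i]
    refine Icc_subset_of_le ?_ ?_ ((hnx c.1).2.1 _ (haF i).2 h1) ((hny c.2).2.1 _ (haG i).2 h3)
    · by_contra! hlt
      exact absurd ((hnx c.1).2.1 _ (haF i).1 hlt) (not_le.2 h2)
    · by_contra! hlt
      exact absurd ((hny c.2).2.1 _ (haG i).1 hlt) (not_le.2 h4)
  let X : Tiling (Fin m ⊕ K) :=
    { l := Sum.elim (fun i => (a i).1) fun c => c.1.1
      r := Sum.elim (fun i => (b i).1) fun c => nx c.1.1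
      b := Sum.elim (fun i => (a i).2) fun c => c.1.2
      t := Sum.elim (fun i => (b i).2) fun c => ny c.1.2
      l_lt_r := by
        rintro (i | c)
        · exact hab1 i
        · exact (hnx _).1
      b_lt_t := by
        rintro (i | c)
        · exact hab2 i
        · exact (hny _).1
      sep := by
        rintro (i | c) (j | d) hne
        · have hij : i ≠ j := fun h => hne (by rw [h])
          have := hdisj i j hij
          rw [hZab i, hZab j] at this
          exact sep_of_disjoint_interior (hab1 i) (hab2 i) (hab1 j) (hab2 j) this
        · exact key i d
        · have := key j c
          simp only [Sum.elim_inl, Sum.elim_inr]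
          tauto
        · simp only [Sum.elim_inr]
          rcases lt_trichotomy c.1.1 d.1.1 with h | h | h
          · exact Or.inl ((hnx _).2.1 _ d.2.1.1 h)
          · rcases lt_trichotomy c.1.2 d.1.2 with h' | h' | h'
            · exact Or.inr (Or.inr (Or.inl ((hny _).2.1 _ d.2.1.2 h')))
            · exact absurd (congrArg Sum.inr (Subtype.ext (Prod.ext h h'))) hne
            · exact Or.inr (Or.inr (Or.inr ((hny _).2.1 _ c.2.1.2 h')))
          · exact Or.inr (Or.inl ((hnx _).2.1 _ c.2.1.1 h)) }
  have hXl : ∀ i, X.rect (Sum.inl i) = Z i := fun i => by rw [rect_eq_Icc, hZab i]; rfl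
  have hXr : ∀ c : K, X.rect (Sum.inr c) = cell c := fun c => by rw [rect_eq_Icc]; rfl
  refine ⟨_, _, inferInstance, X, Sum.inl, Sum.inl_injective, ?_, fun i => (hXl i).ge, rfl⟩
  ext p
  rw [mem_region]
  constructor
  · rintro ⟨i | c, hp⟩
    · rw [hXl] at hp
      exact (hZ i).2 hp
    · rw [hXr] at hp
      obtain ⟨R, hR, hcR⟩ := c.2.2.1
      exact ⟨R, hR, hcR hp⟩
  · rintro ⟨R, hR, hp⟩
    obtain ⟨u, v, ⟨h1, h2⟩, ⟨h3, h4⟩, h5, h6, rfl⟩ := hFG R (Or.inl hR)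
    obtain ⟨x, hxF, hx1, hx2⟩ := exists_grid_interval hnx h1 h2 h5 hp.1.1 hp.2.1
    obtain ⟨y, hyG, hy1, hy2⟩ := exists_grid_interval hny h3 h4 h6 hp.1.2 hp.2.2
    have hpc : p ∈ cell (x, y) := ⟨⟨hx2.1, hy2.1⟩, hx2.2, hy2.2⟩
    by_cases hex : ∃ i, cell (x, y) ⊆ Z i
    · obtain ⟨i, hi⟩ := hex
      exact ⟨Sum.inl i, by rw [hXl]; exact hi hpc⟩
    · push Not at hex
      exact ⟨Sum.inr ⟨(x, y), ⟨hxF, hyG⟩, ⟨_, hR, Icc_subset_of_le hx1.1 hy1.1 hx1.2 hy1.2⟩, hex⟩,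
        by rw [hXr]; exact hpc⟩

theorem Realizable.hasExpansion {C : Set (ℝ × ℝ)} {m b : ℕ} {Z : Fin m → Set (ℝ × ℝ)}
    (h : Realizable C Z (m + b)) : HasExpansion C Z b := by
  classical
  obtain ⟨ι, _, X, τ, hτ, rfl, hZ, hcard⟩ := h
  have hc : Nat.card ((Set.range τ)ᶜ : Set ι) = b := by
    have h1 := Set.ncard_add_ncard_compl (Set.range τ)
    rw [← Set.image_univ, Set.ncard_image_of_injective _ hτ, Set.ncard_univ, Nat.card_fin,
      hcard, Set.image_univ] at h1
    rw [Nat.card_coe_set_eq]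
    omega
  let e : Fin (m + b) ≃ ι := finSumFinEquiv.symm.trans
    ((Equiv.sumCongr (Equiv.ofInjective τ hτ) (Finite.equivFinOfCardEq hc).symm).trans
      (Equiv.Set.sumCompl (Set.range τ)))
  refine ⟨fun j => X.rect (e j), fun j => ?_, fun j k hjk => ?_, ?_, fun i => ?_⟩
  · exact ⟨_, _, X.l_lt_r _, X.b_lt_t _, X.rect_eq_Icc _⟩
  · have hI : ∀ i, interior (X.rect i) =
        Set.Ioo (X.l i) (X.r i) ×ˢ Set.Ioo (X.b i) (X.t i) := fun i => by
      rw [rect_eq_Icc, interior_Icc_eq_prod]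
    rw [hI, hI, Set.disjoint_left]
    rintro p ⟨⟨h1, h2⟩, h3, h4⟩ ⟨⟨h5, h6⟩, h7, h8⟩
    rcases X.sep _ _ (e.injective.ne hjk) with h | h | h | h <;> linarith
  · exact e.surjective.iUnion_comp X.rect
  · have : e (Fin.castAdd b i) = τ i := by simp [e]
    simp only [this]
    exact hZ i

/-! ### The upper bound -/

theorem exists_card_add_le {ι : Type*} [Finite ι] {X : Tiling ι} {P : Set ι} {T : ℕ}
    (hP : ¬ X.Improves P) (hX : X.Connected)
    (hT : {p | IsReflexVertex X.region p}.encard = T) :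
    ∃ a c : ℕ, P.ncard ≤ a * c ∧ Nat.card ι + a + c ≤ 2 * P.ncard + T + 1 := by
  have hP' : ¬ X.swap.Improves P := fun h => hP h.of_swap
  obtain ⟨a, c, h1, h2, h3⟩ := exists_ncard_free_add_le
    (fun κ h => exists_mem_of_not_improves hP h false)
    (fun κ h => exists_mem_of_not_improves hP h true)
    (fun κ h => exists_mem_of_not_improves hP' h false)
    (fun κ h => exists_mem_of_not_improves hP' h true)
  have h4 := card_le_terminal hX
  have h5 := ncard_terminal_le (X := X)
  have h6 := ncard_terminal_le (X := X.swap)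
  have h7 := ncard_gapPoints_le hT
  simp only [gapPoints] at h7
  exact ⟨a, c, h1, by omega⟩

end Tiling

/-- The inequality of arithmetic and geometric means for `a` and `c`. -/
theorem ceil_two_mul_sqrt_sub_one_le {m a c : ℕ} (h : m ≤ a * c) :
    ⌈2 * √(m : ℝ) - 1⌉ ≤ (a : ℤ) + c - 1 := by
  rw [Int.ceil_le]
  push_cast
  have h' : (m : ℝ) ≤ a * c := by exact_mod_cast h
  have : √(m : ℝ) ≤ ((a : ℝ) + c) / 2 := by
    rw [Real.sqrt_le_left (by positivity)]
    nlinarith [sq_nonneg ((a : ℝ) - c)]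
  linarith

/-- A realization with the fewest rectangles cannot be improved, so the count of
`exists_card_add_le` applies to it. -/
theorem exists_hasExpansion_le {m T : ℕ} {C : Set (ℝ × ℝ)} {Z : Fin m → Set (ℝ × ℝ)}
    (hC : IsSimplyConnectedRectilinearPolygon C)
    (hT : {p | IsReflexVertex C p}.encard = (T : ℕ∞)) (hZ : ∀ i, IsAxisRect (Z i) ∧ Z i ⊆ C)
    (hdisj : ∀ i j, i ≠ j → Disjoint (interior (Z i)) (interior (Z j))) :
    ∃ b : ℕ, (b : ℤ) ≤ (m : ℤ) + (T : ℤ) - ⌈2 * √(m : ℝ) - 1⌉ ∧ HasExpansion C Z b := by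
  classical
  have hex := Tiling.exists_realizable hC.exists_rects hZ hdisj
  have hspec := Nat.find_spec hex
  have hmin : ∀ n < Nat.find hex, ¬ Tiling.Realizable C Z n := fun n hn => Nat.find_min hex hn
  generalize Nat.find hex = n at hspec hmin
  have hn := hspec
  obtain ⟨ι, _, X, τ, hτ, rfl, hsub, rfl⟩ := hspec
  have hnot : ¬ X.Improves (Set.range τ) := by
    rintro ⟨q, Y, h1, ⟨i, hi⟩, h3, h4⟩
    refine hmin (Nat.card q) ?_ ⟨q, inferInstance, Y, fun i => ⟨τ i, h1 ⟨i, rfl⟩⟩, ?_, h3, ?_, rfl⟩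
    · exact Finite.card_subtype_lt (p := (· ∈ q)) hi
    · intro i j hij
      exact hτ (Subtype.ext_iff.1 hij)
    · exact fun i => (hsub i).trans (h4 ⟨τ i, _⟩ ⟨i, rfl⟩)
  obtain ⟨a, c, h1, h2⟩ := Tiling.exists_card_add_le hnot
    (Tiling.connected_of_isPreconnected_interior hC.interior_connected.isPreconnected) hT
  have hm : (Set.range τ).ncard = m := by
    rw [← Set.image_univ, Set.ncard_image_of_injective _ hτ, Set.ncard_univ, Nat.card_fin]
  rw [hm] at h1 h2
  have hle : m ≤ Nat.card ι := by
    simpa using Nat.card_le_card_of_injective τ hτ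
  obtain ⟨b, hb⟩ := Nat.exists_eq_add_of_le hle
  refine ⟨b, ?_, Tiling.Realizable.hasExpansion (hb ▸ hn)⟩
  have := ceil_two_mul_sqrt_sub_one_le h1
  omega

/-! ### The staircase polygon -/

/-- The height of the `k`-th column of the staircase polygon. -/
def stairHeight (M : ℝ) (k : ℕ) : ℝ := if k = 0 then M else -k

/-- A square `[-10, M] × [-10, M]` that is enlarged to a staircase with `T` steps at its lower right
corner. -/
def staircase (M : ℝ) (T : ℕ) : Set (ℝ × ℝ) :=
  ⋃ k : Fin (T + 1), Set.Icc (-10, -(T + 10 : ℝ)) (M + (k : ℕ), stairHeight M k)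

theorem stairHeight_strictAnti {M : ℝ} (hM : 0 < M) : StrictAnti (stairHeight M) := by
  intro j k hjk
  have h : (j : ℝ) < k := by exact_mod_cast hjk
  have hj : (0 : ℝ) ≤ j := j.cast_nonneg
  rw [stairHeight, stairHeight, if_neg (by omega)]
  split_ifs <;> linarith

theorem stairHeight_succ (M : ℝ) (k : ℕ) : stairHeight M (k + 1) = -(k + 1 : ℝ) := by
  simp [stairHeight]

theorem neg_le_stairHeight {M : ℝ} (hM : 0 < M) {k T : ℕ} (h : k ≤ T) :
    -(T : ℝ) ≤ stairHeight M k := by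
  have h' : (k : ℝ) ≤ T := by exact_mod_cast h
  have hk : (0 : ℝ) ≤ k := k.cast_nonneg
  rw [stairHeight]
  split_ifs <;> linarith

theorem mem_staircase {M : ℝ} {T : ℕ} {q : ℝ × ℝ} : q ∈ staircase M T ↔
    (-10 ≤ q.1 ∧ -(T + 10 : ℝ) ≤ q.2) ∧ ∃ k ≤ T, q.1 ≤ M + (k : ℕ) ∧ q.2 ≤ stairHeight M k := by
  simp only [staircase, Set.mem_iUnion, Set.mem_Icc, Prod.le_def]
  constructor
  · rintro ⟨⟨k, hk⟩, h1, h2⟩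
    exact ⟨h1, k, by omega, h2⟩
  · rintro ⟨h1, k, hk, h2⟩
    exact ⟨⟨k, by omega⟩, h1, h2⟩

theorem isSimplyConnectedRectilinearPolygon_staircase {M : ℝ} (hM : 0 < M) (T : ℕ) :
    IsSimplyConnectedRectilinearPolygon (staircase M T) where
  exists_rects := by
    refine ⟨_, Set.finite_range fun k : Fin (T + 1) =>
      Set.Icc (-10, -(T + 10 : ℝ)) (M + (k : ℕ), stairHeight M k), ?_, ?_⟩
    · rintro _ ⟨k, rfl⟩
      have hk : (0 : ℝ) ≤ (k : ℕ) := Nat.cast_nonneg _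
      have := neg_le_stairHeight hM (Nat.lt_succ_iff.1 k.2)
      exact ⟨_, _, by simp only; linarith, by simp only; linarith, rfl⟩
    · rw [Set.sUnion_range, staircase]
  interior_connected := by
    let U : Fin (T + 1) → Set (ℝ × ℝ) := fun k =>
      Set.Ioo (-10) (M + (k : ℕ)) ×ˢ Set.Ioo (-(T + 10 : ℝ)) (stairHeight M k)
    have hne : ((-5 : ℝ), -(T + 9 : ℝ)) ∈ ⋂ k, U k := by
      refine Set.mem_iInter.2 fun k => ?_
      have hk : (0 : ℝ) ≤ (k : ℕ) := Nat.cast_nonneg _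
      have := neg_le_stairHeight hM (Nat.lt_succ_iff.1 k.2)
      exact ⟨⟨by norm_num, by simp only; linarith⟩, by simp only; linarith, by simp only; linarith⟩
    have hpre : IsPreconnected (⋃ k, U k) := isPreconnected_iUnion ⟨_, hne⟩
      fun k => isPreconnected_Ioo.prod isPreconnected_Ioo
    have hsub : (⋃ k, U k) ⊆ interior (staircase M T) := by
      refine Set.iUnion_subset fun k => ?_
      have : U k = interior (Set.Icc (-10, -(T + 10 : ℝ)) (M + (k : ℕ), stairHeight M k)) := by
        rw [interior_Icc_eq_prod]
      rw [this]
      exact interior_mono (Set.subset_iUnion (fun k : Fin (T + 1) =>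
        Set.Icc (-10, -(T + 10 : ℝ)) (M + (k : ℕ), stairHeight M k)) k)
    have hcl : staircase M T ⊆ closure (⋃ k, U k) := by
      refine Set.iUnion_subset fun k => ?_
      have hk : (0 : ℝ) ≤ (k : ℕ) := Nat.cast_nonneg _
      have := neg_le_stairHeight hM (Nat.lt_succ_iff.1 k.2)
      have : Set.Icc (-10, -(T + 10 : ℝ)) (M + (k : ℕ), stairHeight M k) = closure (U k) := by
        rw [closure_prod_eq, closure_Ioo (by linarith), closure_Ioo (by linarith),
          Set.Icc_prod_eq]
      rw [this]
      exact closure_mono (Set.subset_iUnion U k)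
    exact ⟨⟨_, hsub (Set.mem_iUnion.2 ⟨0, Set.mem_iInter.1 hne 0⟩)⟩,
      hpre.subset_closure hsub (interior_subset.trans hcl)⟩
  simply_connected := by
    -- All the rectangles of the union share their lower left corner, so it sees every point.
    have hstar : StarConvex ℝ ((-10 : ℝ), -(T + 10 : ℝ)) (staircase M T) := by
      intro q hq a b ha hb hab
      rw [mem_staircase] at hq ⊢
      obtain ⟨⟨h1, h2⟩, k, hk, h3, h4⟩ := hq
      obtain rfl : a = 1 - b := by linarith
      simp only [Prod.smul_mk, smul_eq_mul, Prod.fst_add, Prod.snd_add, Prod.smul_fst,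
        Prod.smul_snd]
      exact ⟨⟨by nlinarith, by nlinarith⟩, k, hk, by nlinarith, by nlinarith⟩
    have hne : (staircase M T).Nonempty := by
      refine ⟨(-10, -(T + 10 : ℝ)), mem_staircase.2 ⟨⟨le_rfl, le_rfl⟩, 0, Nat.zero_le _, ?_, ?_⟩⟩
      · simp; linarith
      · have := neg_le_stairHeight hM (Nat.zero_le T)
        simp only; linarith
    have := hstar.contractibleSpace hne
    exact (inferInstance : SimplyConnectedSpace (staircase M T))

theorem mem_staircase_of_le {M : ℝ} {T : ℕ} {q q' : ℝ × ℝ} (hq : q ∈ staircase M T)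
    (h1 : -10 ≤ q'.1) (h2 : -(T + 10 : ℝ) ≤ q'.2) (h3 : q'.1 ≤ q.1) (h4 : q'.2 ≤ q.2) :
    q' ∈ staircase M T := by
  rw [mem_staircase] at hq ⊢
  obtain ⟨-, k, hk, h5, h6⟩ := hq
  exact ⟨⟨h1, h2⟩, k, hk, h3.trans h5, h4.trans h6⟩

theorem isReflexVertex_staircase {M : ℝ} (hM : 0 < M) {k T : ℕ} (hk : k < T) :
    IsReflexVertex (staircase M T) (M + k, stairHeight M (k + 1)) := by
  have hanti := stairHeight_strictAnti hM
  have hlt : stairHeight M (k + 1) < stairHeight M k := hanti (Nat.lt_succ_self k)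
  have hlow := neg_le_stairHeight hM (Nat.succ_le_of_lt hk)
  have hk0 : (0 : ℝ) ≤ k := k.cast_nonneg
  refine ⟨1, 1, Or.inl rfl, Or.inl rfl, min 1 (stairHeight M k - stairHeight M (k + 1)),
    lt_min one_pos (by linarith), fun q h1 h2 => ?_⟩
  simp only at h1 h2
  rw [lt_min_iff, abs_lt, abs_lt] at h1 h2
  rw [mem_staircase, one_mul, one_mul]
  constructor
  · rintro ⟨-, j, hj, h3, h4⟩ ⟨h5, h6⟩
    have hkj : k < j := by
      have : (k : ℝ) < j := by linarith
      exact_mod_cast this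
    have := hanti.antitone (Nat.succ_le_of_lt hkj)
    simp only [Nat.succ_eq_add_one] at this
    linarith
  · intro h
    refine ⟨⟨by linarith, by linarith⟩, ?_⟩
    by_cases h3 : q.1 ≤ M + k
    · exact ⟨k, hk.le, h3, by linarith⟩
    · refine ⟨k + 1, hk, by push_cast; linarith, ?_⟩
      by_contra! h4
      exact h ⟨by linarith, by linarith⟩

/-- The polygon is closed under moving left and down within its outer bounds, so the missing
quadrant is the upper right one. The vertex then lies on the right side of one column, at the height
of the next. -/
theorem IsReflexVertex.exists_eq_of_staircase {M : ℝ} (hM : 0 < M) {T : ℕ} {p : ℝ × ℝ}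
    (h : IsReflexVertex (staircase M T) p) : ∃ k < T, (M + k, stairHeight M (k + 1)) = p := by
  have hanti := stairHeight_strictAnti hM
  obtain ⟨s, t, hs, ht, ε, hε, h⟩ := h
  have habs : ∀ σ : ℝ, (σ = 1 ∨ σ = -1 ∨ σ = 0) → ∀ δ, 0 < δ → δ < ε → ∀ x,
      |x + σ * δ - x| < ε := by
    intro σ hσ δ hδ hδε x
    rw [add_sub_cancel_left, abs_lt]
    rcases hσ with rfl | rfl | rfl <;> constructor <;> linarith
  have hmem : ∀ σ τ : ℝ, (σ = 1 ∨ σ = -1 ∨ σ = 0) → (τ = 1 ∨ τ = -1 ∨ τ = 0) → ∀ δ, 0 < δ → δ < ε →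
      ((p.1 + σ * δ, p.2 + τ * δ) ∈ staircase M T ↔ ¬ (0 < s * (σ * δ) ∧ 0 < t * (τ * δ))) := by
    intro σ τ hσ hτ δ h1 h2
    have := h (p.1 + σ * δ, p.2 + τ * δ) (habs σ hσ δ h1 h2 _) (habs τ hτ δ h1 h2 _)
    simpa only [add_sub_cancel_left] using this
  have hδ := half_pos hε
  have hδ' := half_lt_self hε
  set δ := ε / 2
  have hx : -10 ≤ p.1 - δ := by
    have := (mem_staircase.1 ((hmem (-1) 0 (by simp) (by simp) δ hδ hδ').2 (by simp))).1.1
    simp only at this; linarith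
  have hy : -(T + 10 : ℝ) ≤ p.2 - δ := by
    have := (mem_staircase.1 ((hmem 0 (-1) (by simp) (by simp) δ hδ hδ').2 (by simp))).1.2
    simp only at this; linarith
  have hs1 : s = 1 := by
    refine hs.resolve_right fun hs => ?_
    subst hs
    have ht' : t = 1 ∨ t = -1 ∨ t = 0 := by tauto
    have htt : t * t = 1 := by rcases ht with rfl | rfl <;> norm_num
    have h1 := (hmem 0 t (by simp) ht' δ hδ hδ').2 (by simp)
    have h2 := (hmem (-1) t (by simp) ht' δ hδ hδ').1 (mem_staircase_of_le h1 (by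
      simp only; linarith) (by rcases ht with rfl | rfl <;> simp only <;> linarith) (by
      simp only; linarith) le_rfl)
    exact h2 ⟨by linarith, by nlinarith⟩
  have ht1 : t = 1 := by
    refine ht.resolve_right fun ht => ?_
    subst ht hs1
    have h1 := (hmem 1 0 (by simp) (by simp) δ hδ hδ').2 (by simp)
    have h2 := (hmem 1 (-1) (by simp) (by simp) δ hδ hδ').1 (mem_staircase_of_le h1 (by
      simp only; linarith) (by simp only; linarith) le_rfl (by simp only; linarith))
    exact h2 ⟨by linarith, by linarith⟩
  subst hs1 ht1
  obtain ⟨-, k₀, hk₀, h1, h2⟩ :=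
    mem_staircase.1 ((hmem 1 0 (by simp) (by simp) δ hδ hδ').2 (by simp))
  obtain ⟨-, j, hj, h3, h4⟩ :=
    mem_staircase.1 ((hmem 0 1 (by simp) (by simp) δ hδ hδ').2 (by simp))
  simp only at h1 h2 h3 h4
  classical
  -- The first column that extends strictly to the right of `p` sets the height there.
  have hex : ∃ k : ℕ, p.1 < M + k := ⟨k₀, by linarith⟩
  have hspec := Nat.find_spec hex
  have hmin : ∀ i < Nat.find hex, M + i ≤ p.1 := fun i hi => not_lt.1 (Nat.find_min hex hi)
  have hle : ∀ i : ℕ, p.1 < M + i → Nat.find hex ≤ i := fun i hi => Nat.find_min' hex hi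
  generalize Nat.find hex = k at hspec hmin hle
  have hkk₀ : k ≤ k₀ := hle k₀ (by linarith)
  have hpk : p.2 ≤ stairHeight M k := by linarith [hanti.antitone hkk₀]
  have hpeq : p.2 = stairHeight M k := by
    refine le_antisymm hpk ?_
    by_contra! hlt
    obtain ⟨η, hη0, hη⟩ := exists_between (lt_min hδ (lt_min (sub_pos.2 hspec) (sub_pos.2 hlt)))
    rw [lt_min_iff, lt_min_iff] at hη
    refine (hmem 1 1 (by simp) (by simp) η hη0 (hη.1.trans hδ')).1 (mem_staircase.2
      ⟨⟨by simp only; linarith, by simp only; linarith⟩, k, by omega, by simp only; linarith,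
        by simp only; linarith⟩) ⟨by linarith, by linarith⟩
  have hjk : j < k := by
    by_contra! hkj
    linarith [hanti.antitone hkj]
  have hpj : p.1 = M + j := le_antisymm (by linarith) (hmin j hjk)
  have hkj : k = j + 1 := le_antisymm (hle (j + 1) (by push_cast; linarith)) hjk
  exact ⟨j, by omega, Prod.ext hpj.symm (by rw [hpeq, hkj])⟩

theorem encard_isReflexVertex_staircase {M : ℝ} (hM : 0 < M) (T : ℕ) :
    {p | IsReflexVertex (staircase M T) p}.encard = (T : ℕ∞) := by
  have hset : {p | IsReflexVertex (staircase M T) p} =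
      (fun k : ℕ => (M + (k : ℝ), stairHeight M (k + 1))) '' (Finset.range T : Set ℕ) := by
    ext p
    simp only [Set.mem_ofPred_eq, Set.mem_image, Finset.coe_range, Set.mem_Iio]
    constructor
    · exact fun h => h.exists_eq_of_staircase hM
    · rintro ⟨k, hk, rfl⟩
      exact isReflexVertex_staircase hM hk
  have hinj : Function.Injective fun k : ℕ => (M + (k : ℝ), stairHeight M (k + 1)) := by
    intro j k hjk
    have := congrArg Prod.fst hjk
    simpa using this
  rw [hset, hinj.encard_image, Set.encard_coe_eq_coe_finsetCard, Finset.card_range]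

theorem le_stairHeight_of_mem_staircase {M : ℝ} (hM : 0 < M) {k T : ℕ} {y : ℝ}
    (h : (M + (k : ℝ), y) ∈ staircase M T) : y ≤ stairHeight M k := by
  obtain ⟨-, j, hj, h1, h2⟩ := mem_staircase.1 h
  have hkj : k ≤ j := by
    have : (k : ℝ) ≤ j := by simp only at h1; linarith
    exact_mod_cast this
  exact h2.trans ((stairHeight_strictAnti hM).antitone hkj)

theorem corner_mem_staircase {M : ℝ} (hM : 0 < M) {k T : ℕ} (hk : k ≤ T) :
    (M + (k : ℝ), stairHeight M k) ∈ staircase M T := by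
  have hk0 : (0 : ℝ) ≤ k := k.cast_nonneg
  have := neg_le_stairHeight hM hk
  exact mem_staircase.2 ⟨⟨by simp only; linarith, by simp only; linarith⟩, k, hk, le_rfl, le_rfl⟩

/-! ### Witness points that force blanks -/

theorem IsAxisRect.mem_of_between {R : Set (ℝ × ℝ)} (hR : IsAxisRect R) {p q : ℝ × ℝ} (hp : p ∈ R)
    (hq : q ∈ R) {x y : ℝ} (hx : p.1 ≤ x ∧ x ≤ q.1 ∨ q.1 ≤ x ∧ x ≤ p.1)
    (hy : p.2 ≤ y ∧ y ≤ q.2 ∨ q.2 ≤ y ∧ y ≤ p.2) : (x, y) ∈ R := by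
  obtain ⟨a, b, -, -, rfl⟩ := hR
  obtain ⟨⟨h1, h2⟩, h3, h4⟩ := hp
  obtain ⟨⟨h5, h6⟩, h7, h8⟩ := hq
  refine ⟨⟨?_, ?_⟩, ?_, ?_⟩ <;> simp only <;> rcases hx with hx | hx <;> rcases hy with hy | hy <;>
    linarith

theorem IsAxisRect.subset_closure_interior {R : Set (ℝ × ℝ)} (hR : IsAxisRect R) :
    R ⊆ closure (interior R) := by
  obtain ⟨a, b, h1, h2, rfl⟩ := hR
  rw [interior_Icc_eq_prod, closure_prod_eq, closure_Ioo h1.ne, closure_Ioo h2.ne,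
    ← Set.Icc_prod_eq]

/-- Points no two of which fit into a rectangle that avoids the toppings, and none of which fits
into a rectangle with one topping that avoids the others, bound the number of blanks from below. -/
theorem HasExpansion.card_le {C : Set (ℝ × ℝ)} {m b : ℕ} {Z : Fin m → Set (ℝ × ℝ)}
    (h : HasExpansion C Z b) {α : Type*} [Fintype α] (w : α → ℝ × ℝ) (hw : ∀ x, w x ∈ C)
    (h1 : ∀ x i R, IsAxisRect R → R ⊆ C → w x ∈ R → Z i ⊆ R →
      ∃ i' ≠ i, (R ∩ interior (Z i')).Nonempty)
    (h2 : ∀ x y R, x ≠ y → IsAxisRect R → R ⊆ C → w x ∈ R → w y ∈ R →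
      ∃ i, (R ∩ interior (Z i)).Nonempty) : Fintype.card α ≤ b := by
  obtain ⟨P, hP, hdisj, rfl, hZ⟩ := h
  -- A piece that meets the interior of a topping is the piece holding that topping.
  have havoid : ∀ j i, (P j ∩ interior (Z i)).Nonempty → j = Fin.castAdd b i := by
    rintro j i ⟨p, hp, hpi⟩
    by_contra hne
    have h3 := mem_closure_iff.1 ((hP j).subset_closure_interior hp) _ isOpen_interior hpi
    obtain ⟨q, hq1, hq2⟩ := h3
    exact Set.disjoint_left.1 (hdisj _ _ hne) hq2 (interior_mono (hZ i) hq1)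
  have hsub : ∀ j, P j ⊆ ⋃ j, P j := Set.subset_iUnion P
  have hex : ∀ x, ∃ j : Fin b, w x ∈ P (Fin.natAdd m j) := by
    intro x
    obtain ⟨j, hj⟩ := Set.mem_iUnion.1 (hw x)
    induction j using Fin.addCases with
    | left i =>
      obtain ⟨i', hne, hi'⟩ := h1 x i _ (hP _) (hsub _) hj (hZ i)
      exact absurd (Fin.castAdd_injective _ _ (havoid _ _ hi')) hne.symm
    | right j => exact ⟨j, hj⟩
  choose f hf using hex
  have hinj : Function.Injective f := by
    intro x y hxy
    by_contra hne
    obtain ⟨i, hi⟩ := h2 x y _ hne (hP _) (hsub _) (hf x) (hxy ▸ hf y)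
    have := congrArg Fin.val (havoid _ _ hi)
    simp at this
    omega
  simpa using Fintype.card_le_of_injective f hinj

/-! ### The checkerboard of toppings and its pinwheels -/

/-- Half the width of the topping in a given column and row of the checkerboard. -/
def halfWidth (c r : ℕ) : ℤ := if (c + r) % 2 = 0 then 6 else 3

/-- Half the height of the topping in a given column and row of the checkerboard. -/
def halfHeight (c r : ℕ) : ℤ := if (c + r) % 2 = 0 then 3 else 6

/-- A topping of a checkerboard of wide and tall rectangles around the points of `10 ℤ × 10 ℤ`. -/
def topping (c r : ℕ) : Set (ℝ × ℝ) :=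
  Set.Icc (((10 * c - halfWidth c r : ℤ) : ℝ), ((10 * r - halfHeight c r : ℤ) : ℝ))
    (((10 * c + halfWidth c r : ℤ) : ℝ), ((10 * r + halfHeight c r : ℤ) : ℝ))

theorem halfWidth_eq_or (c r : ℕ) : (halfWidth c r = 6 ∧ halfHeight c r = 3 ∧ (c + r) % 2 = 0) ∨
    (halfWidth c r = 3 ∧ halfHeight c r = 6 ∧ (c + r) % 2 = 1) := by
  unfold halfWidth halfHeight
  split_ifs with h
  · simp [h]
  · right; simp; omega

theorem isAxisRect_topping (c r : ℕ) : IsAxisRect (topping c r) := by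
  refine ⟨_, _, ?_, ?_, rfl⟩ <;> simp only [Int.cast_lt] <;>
    rcases halfWidth_eq_or c r with ⟨h1, h2, -⟩ | ⟨h1, h2, -⟩ <;> omega

theorem mem_interior_topping {c r : ℕ} {x y : ℤ} (hx1 : 10 * c - halfWidth c r < x)
    (hx2 : x < 10 * c + halfWidth c r) (hy1 : 10 * r - halfHeight c r < y)
    (hy2 : y < 10 * r + halfHeight c r) : ((x : ℝ), (y : ℝ)) ∈ interior (topping c r) := by
  rw [topping, interior_Icc_eq_prod]
  exact ⟨⟨Int.cast_lt.2 hx1, Int.cast_lt.2 hx2⟩, Int.cast_lt.2 hy1, Int.cast_lt.2 hy2⟩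

theorem center_mem_interior_topping (c r : ℕ) :
    (((10 * c : ℤ) : ℝ), ((10 * r : ℤ) : ℝ)) ∈ interior (topping c r) := by
  apply mem_interior_topping <;>
    rcases halfWidth_eq_or c r with ⟨h1, h2, -⟩ | ⟨h1, h2, -⟩ <;> omega

/-- Horizontal or vertical neighbours are of different kinds and `6 + 3 < 10`; diagonal neighbours
are of the same kind and `3 + 3 < 10` in their short direction. -/
theorem disjoint_topping {c r c' r' : ℕ} (h : c ≠ c' ∨ r ≠ r') :
    Disjoint (topping c r) (topping c' r') := by
  rw [Set.disjoint_left]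
  rintro p ⟨⟨h1, h2⟩, h3, h4⟩ ⟨⟨h5, h6⟩, h7, h8⟩
  have e1 := Int.cast_le.1 (h1.trans h7)
  have e2 := Int.cast_le.1 (h5.trans h3)
  have e3 := Int.cast_le.1 (h2.trans h8)
  have e4 := Int.cast_le.1 (h6.trans h4)
  rcases halfWidth_eq_or c r with ⟨a1, a2, a3⟩ | ⟨a1, a2, a3⟩ <;>
    rcases halfWidth_eq_or c' r' with ⟨b1, b2, b3⟩ | ⟨b1, b2, b3⟩ <;>
    rw [a1, b1] at e1 e2 <;> rw [a2, b2] at e3 e4 <;> omega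

theorem topping_subset_staircase {c r m : ℕ} (hc : c ≤ m) (hr : r ≤ m) (T : ℕ) :
    topping c r ⊆ staircase (10 * m + 10) T := by
  rintro p ⟨⟨h1, h2⟩, h3, h4⟩
  have hT : (0 : ℝ) ≤ T := T.cast_nonneg
  have e1 : (-6 : ℤ) ≤ 10 * c - halfWidth c r := by
    rcases halfWidth_eq_or c r with ⟨h1, h2, -⟩ | ⟨h1, h2, -⟩ <;> omega
  have e2 : (-6 : ℤ) ≤ 10 * r - halfHeight c r := by
    rcases halfWidth_eq_or c r with ⟨h1, h2, -⟩ | ⟨h1, h2, -⟩ <;> omega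
  have e3 : 10 * c + halfWidth c r ≤ 10 * (m : ℤ) + 10 := by
    rcases halfWidth_eq_or c r with ⟨h1, h2, -⟩ | ⟨h1, h2, -⟩ <;> omega
  have e4 : 10 * r + halfHeight c r ≤ 10 * (m : ℤ) + 10 := by
    rcases halfWidth_eq_or c r with ⟨h1, h2, -⟩ | ⟨h1, h2, -⟩ <;> omega
  have f1 := (Int.cast_le (R := ℝ)).2 e1
  have f2 := (Int.cast_le (R := ℝ)).2 e2
  have f3 := h3.trans ((Int.cast_le (R := ℝ)).2 e3)
  have f4 := h4.trans ((Int.cast_le (R := ℝ)).2 e4)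
  rw [Int.cast_neg, Int.cast_ofNat] at f1 f2
  push_cast at f3 f4
  simp only at h1 h2
  refine mem_staircase.2 ⟨⟨by linarith, by linarith⟩, 0, Nat.zero_le _, ?_, ?_⟩
  · simpa using f3
  · simpa [stairHeight] using f4

/-- The middle of the pinwheel of the four toppings in the columns `c`, `c + 1` and the rows `r`,
`r + 1`. -/
def pinwheelCenter (c r : ℕ) : ℝ × ℝ := (((10 * c + 5 : ℤ) : ℝ), ((10 * r + 5 : ℤ) : ℝ))

theorem pinwheelCenter_mem_staircase {c r m : ℕ} (hc : c ≤ m) (hr : r ≤ m) (T : ℕ) :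
    pinwheelCenter c r ∈ staircase (10 * m + 10) T := by
  have hT : (0 : ℝ) ≤ T := T.cast_nonneg
  have hc' : (c : ℝ) ≤ m := by exact_mod_cast hc
  have hr' : (r : ℝ) ≤ m := by exact_mod_cast hr
  have hc0 : (0 : ℝ) ≤ c := c.cast_nonneg
  have hr0 : (0 : ℝ) ≤ r := r.cast_nonneg
  refine mem_staircase.2 ⟨⟨?_, ?_⟩, 0, Nat.zero_le _, ?_, ?_⟩ <;>
    simp only [pinwheelCenter, stairHeight, if_true] <;> push_cast <;> linarith

theorem IsAxisRect.int_mem_of_between {R : Set (ℝ × ℝ)} (hR : IsAxisRect R) {x₁ y₁ x₂ y₂ : ℤ}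
    (h₁ : ((x₁ : ℝ), (y₁ : ℝ)) ∈ R)
    (h₂ : ((x₂ : ℝ), (y₂ : ℝ)) ∈ R) {x y : ℤ} (hx : x₁ ≤ x ∧ x ≤ x₂ ∨ x₂ ≤ x ∧ x ≤ x₁)
    (hy : y₁ ≤ y ∧ y ≤ y₂ ∨ y₂ ≤ y ∧ y ≤ y₁) : ((x : ℝ), (y : ℝ)) ∈ R :=
  hR.mem_of_between h₁ h₂ (by simpa only [Int.cast_le] using hx)
    (by simpa only [Int.cast_le] using hy)

/-- A rectangle that contains the middle of a pinwheel and a topping meets another topping of the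
pinwheel. -/
theorem IsAxisRect.exists_topping_of_center {R : Set (ℝ × ℝ)} (hR : IsAxisRect R) {c r c' r' : ℕ}
    (hw : pinwheelCenter c r ∈ R)
    (hZ : topping c' r' ⊆ R) : ∃ c'' r'', (c'' = c ∨ c'' = c + 1) ∧ (r'' = r ∨ r'' = r + 1) ∧
      (c'' ≠ c' ∨ r'' ≠ r') ∧ (R ∩ interior (topping c'' r'')).Nonempty := by
  have hz := hZ (interior_subset (center_mem_interior_topping c' r'))
  -- The topping of the pinwheel nearest to the given one. If it is a different one, its centre lies
  -- between the given centre and the middle.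
  obtain ⟨c₁, hc₁, hc⟩ : ∃ c₁, (c₁ = c ∨ c₁ = c + 1) ∧ (c' ≤ c ∧ c₁ = c ∨ c < c' ∧ c₁ = c + 1) := by
    rcases le_or_gt c' c with h | h
    · exact ⟨c, by simp [h]⟩
    · exact ⟨c + 1, by simp [h]⟩
  obtain ⟨r₁, hr₁, hr⟩ : ∃ r₁, (r₁ = r ∨ r₁ = r + 1) ∧ (r' ≤ r ∧ r₁ = r ∨ r < r' ∧ r₁ = r + 1) := by
    rcases le_or_gt r' r with h | h
    · exact ⟨r, by simp [h]⟩
    · exact ⟨r + 1, by simp [h]⟩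
  by_cases he : c₁ = c' ∧ r₁ = r'
  · obtain ⟨rfl, rfl⟩ := he
    rcases halfWidth_eq_or c₁ r₁ with ⟨-, -, h3⟩ | ⟨-, -, h3⟩
    -- A wide topping of the pinwheel: its vertical neighbour, in the other row `2 * r + 1 - r₁`, is
    -- tall and reaches past the level of the middle, as `5 < 6`.
    · refine ⟨c₁, 2 * r + 1 - r₁, hc₁, by omega, Or.inr (by omega), _,
        hR.int_mem_of_between hw hz (x := 10 * c₁) (y := 10 * r + 5) (by omega) (by omega),
        ?_⟩
      have := halfWidth_eq_or c₁ (2 * r + 1 - r₁)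
      apply mem_interior_topping <;> omega
    · refine ⟨2 * c + 1 - c₁, r₁, by omega, hr₁, Or.inl (by omega), _,
        hR.int_mem_of_between hw hz (x := 10 * c + 5) (y := 10 * r₁) (by omega) (by omega),
        ?_⟩
      have := halfWidth_eq_or (2 * c + 1 - c₁) r₁
      apply mem_interior_topping <;> omega
  · exact ⟨c₁, r₁, hc₁, hr₁, by tauto, _, hR.int_mem_of_between hw hz (by omega) (by omega),
      center_mem_interior_topping _ _⟩

/-- A rectangle that contains the middles of two pinwheels meets a topping of one of them. -/
theorem IsAxisRect.exists_topping_of_centers {R : Set (ℝ × ℝ)} (hR : IsAxisRect R) {c r c' r' : ℕ}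
    (hw : pinwheelCenter c r ∈ R)
    (hw' : pinwheelCenter c' r' ∈ R) (hne : c < c' ∨ c = c' ∧ r < r') :
    ∃ c'' r'', (c'' = c ∨ c'' = c + 1) ∧ (r'' = r ∨ r'' = r + 1) ∧
      (R ∩ interior (topping c'' r'')).Nonempty := by
  rcases hne with hc | ⟨rfl, hr⟩
  · rcases lt_trichotomy r r' with hr | rfl | hr
    · exact ⟨c + 1, r + 1, Or.inr rfl, Or.inr rfl, _, hR.int_mem_of_between hw hw'
        (by omega) (by omega), center_mem_interior_topping _ _⟩
    -- Between two middles in the same row, the tall topping in the next column bars the way.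
    · obtain ⟨r₁, hr₁, h⟩ : ∃ r₁, (r₁ = r ∨ r₁ = r + 1) ∧ (c + 1 + r₁) % 2 = 1 := by
        rcases Nat.mod_two_eq_zero_or_one (c + r) with h | h
        · exact ⟨r, by omega⟩
        · exact ⟨r + 1, by omega⟩
      refine ⟨c + 1, r₁, Or.inr rfl, hr₁, _, hR.int_mem_of_between hw hw' (x := 10 * (c + 1))
        (y := 10 * r + 5) (by omega) (by omega), ?_⟩
      have := halfWidth_eq_or (c + 1) r₁
      apply mem_interior_topping <;> push_cast <;> omega
    · exact ⟨c + 1, r, Or.inr rfl, Or.inl rfl, _, hR.int_mem_of_between hw hw'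
        (by omega) (by omega), center_mem_interior_topping _ _⟩
  · obtain ⟨c₁, hc₁, h⟩ : ∃ c₁, (c₁ = c ∨ c₁ = c + 1) ∧ (c₁ + (r + 1)) % 2 = 0 := by
      rcases Nat.mod_two_eq_zero_or_one (c + r) with h | h
      · exact ⟨c + 1, by omega⟩
      · exact ⟨c, by omega⟩
    refine ⟨c₁, r + 1, hc₁, Or.inr rfl, _, hR.int_mem_of_between hw hw' (x := 10 * c + 5)
      (y := 10 * (r + 1)) (by omega) (by omega), ?_⟩
    have := halfWidth_eq_or c₁ (r + 1)
    apply mem_interior_topping <;> push_cast <;> omega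

/-- A rectangle in the staircase polygon that contains the corner of a step lies below the height of
this step. -/
theorem IsAxisRect.le_stairHeight {R : Set (ℝ × ℝ)} (hR : IsAxisRect R) {M : ℝ} (hM : 0 < M) {T k : ℕ}
    (hsub : R ⊆ staircase M T)
    {y : ℝ} (hk : (M + (k : ℝ), y) ∈ R) {q : ℝ × ℝ} (hq : q ∈ R) : q.2 ≤ stairHeight M k :=
  le_stairHeight_of_mem_staircase hM (hsub (hR.mem_of_between hk hq
    (Or.elim (le_total (M + (k : ℝ)) q.1) (fun h => Or.inl ⟨le_rfl, h⟩) fun h => Or.inr ⟨h, le_rfl⟩)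
    (Or.elim (le_total y q.2) (fun h => Or.inl ⟨h, le_rfl⟩) fun h => Or.inr ⟨le_rfl, h⟩)))

/-- The first `m` squares of a checkerboard with `√m` rows contain many full pinwheels. -/
theorem exists_pinwheel_count {m : ℕ} (hm : m ≠ 0) : ∃ s, s ≤ m ∧ s * s < 4 * m ∧ ∀ h < m - s,
    0 < m.sqrt - 1 ∧
      (h / (m.sqrt - 1)) * m.sqrt + h % (m.sqrt - 1) + m.sqrt + 1 < m := by
  have h1 := Nat.sqrt_le m
  have h2 := Nat.sqrt_le_add m
  have h3 : 0 < m.sqrt := Nat.sqrt_pos.2 (Nat.pos_of_ne_zero hm)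
  generalize m.sqrt = k at *
  obtain ⟨d, rfl⟩ := Nat.exists_eq_add_of_lt h3
  simp only [zero_add, Nat.add_sub_cancel] at *
  -- With `d + 1` rows, the pinwheel `h` sits in column `h / d` and row `h % d`. This is the index
  -- of its lower left topping; the upper right one comes `d + 2` later.
  have key : ∀ h, (h / d) * (d + 1) + h % d = h + h / d := by
    intro h
    have := Nat.div_add_mod h d
    nlinarith
  have hQ : ∀ h, d * (h / d) ≤ h := fun h => Nat.mul_div_le h d
  -- In each of the three cases `s` equals `⌈2√m⌉ - 1`, according to whether `m` is a square, at
  -- most half-way to the next one, or beyond.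
  by_cases hA : m = (d + 1) * (d + 1)
  · refine ⟨2 * d + 1, by nlinarith, by nlinarith, fun h hh => ?_⟩
    have hh' : h < d * d := by
      have : m = d * d + (2 * d + 1) := by rw [hA]; ring
      omega
    have hd : 0 < d := by
      rcases Nat.eq_zero_or_pos d with rfl | hd
      · simp at hh'
      · exact hd
    refine ⟨hd, ?_⟩
    rw [key]
    have : h / d < d := (Nat.div_lt_iff_lt_mul hd).2 hh'
    nlinarith
  · by_cases hB : m ≤ (d + 1) * (d + 1) + (d + 1)
    · refine ⟨2 * (d + 1), ?_, ?_, fun h hh => ?_⟩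
      · rcases Nat.eq_zero_or_pos d with rfl | hd
        · omega
        · nlinarith
      · have := lt_of_le_of_ne h1 (Ne.symm hA)
        nlinarith
      · obtain ⟨e, rfl⟩ := Nat.exists_eq_add_of_le h1
        have hh' : h + 2 ≤ d * d + e := by
          have : (d + 1) * (d + 1) + e = d * d + 2 * d + 1 + e := by ring
          omega
        have hd : 0 < d := by
          rcases Nat.eq_zero_or_pos d with rfl | hd
          · omega
          · exact hd
        refine ⟨hd, ?_⟩
        rw [key]
        have : h / d < d + 1 := (Nat.div_lt_iff_lt_mul hd).2 (by nlinarith)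
        nlinarith
    · refine ⟨2 * (d + 1) + 1, ?_, by nlinarith, fun h hh => ?_⟩
      · nlinarith
      · obtain ⟨e, rfl⟩ := Nat.exists_eq_add_of_le h1
        have hh' : h + 3 ≤ d * d + e := by
          have : (d + 1) * (d + 1) + e = d * d + 2 * d + 1 + e := by ring
          omega
        have hd : 0 < d := by
          rcases Nat.eq_zero_or_pos d with rfl | hd
          · omega
          · exact hd
        refine ⟨hd, ?_⟩
        rw [key]
        have : h / d < d + 2 := (Nat.div_lt_iff_lt_mul hd).2 (by nlinarith)
        nlinarith

theorem le_ceil_two_mul_sqrt_sub_one {m s : ℕ} (h : s * s < 4 * m) :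
    (s : ℤ) ≤ ⌈2 * √(m : ℝ) - 1⌉ := by
  rw [← Int.sub_one_lt_iff, Int.lt_ceil]
  push_cast
  have h' : (s : ℝ) * s < 4 * m := by exact_mod_cast h
  have : (s : ℝ) / 2 < √(m : ℝ) := Real.lt_sqrt_of_sq_lt (by nlinarith)
  linarith

/-- The `i`-th topping of the checkerboard with `√m` rows. -/
def checkerboard (m : ℕ) (i : Fin m) : Set (ℝ × ℝ) := topping (i / m.sqrt) (i % m.sqrt)

/-- The witnesses are `m - s` pinwheel middles and the outer corners of the `T` steps. A rectangle
through such a corner stays at or below the height of its step, which is negative, while all middles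
and topping centres have nonnegative height. -/
theorem HasExpansion.le_of_checkerboard {m T b : ℕ}
    (h : HasExpansion (staircase (10 * m + 10) T) (checkerboard m) b) :
    (m : ℤ) + T - ⌈2 * √(m : ℝ) - 1⌉ ≤ b := by
  have hM : (0 : ℝ) < 10 * m + 10 := by positivity
  have hanti := stairHeight_strictAnti hM
  have hcorner : ∀ (k k' : ℕ) R, k ≠ k' → IsAxisRect R → R ⊆ staircase (10 * m + 10) T →
      ((10 * m + 10 : ℝ) + (k : ℝ), stairHeight (10 * m + 10) k) ∈ R →
      ((10 * m + 10 : ℝ) + (k' : ℝ), stairHeight (10 * m + 10) k') ∈ R → False := by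
    intro k k' R hkk' hR hsub hk hk'
    rcases lt_or_gt_of_ne hkk' with hlt | hlt
    · exact absurd (hR.le_stairHeight hM hsub hk' hk) (not_le.2 (hanti hlt))
    · exact absurd (hR.le_stairHeight hM hsub hk hk') (not_le.2 (hanti hlt))
  -- Without toppings the ceiling is `-1`, so `T + 1` witnesses are needed: the upper right corner
  -- of the square, `k = 0`, is one as well.
  rcases eq_or_ne m 0 with rfl | hm
  · have := h.card_le (α := Fin (T + 1))
      (fun k => ((10 * (0 : ℕ) + 10 : ℝ) + (k : ℕ), stairHeight (10 * (0 : ℕ) + 10) k))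
      (fun k => corner_mem_staircase hM (Nat.lt_succ_iff.1 k.2)) (fun _ i => i.elim0)
      (fun k k' R hkk' hR hsub hk hk' =>
        (hcorner k k' R (Fin.val_injective.ne hkk') hR hsub hk hk').elim)
    rw [Fintype.card_fin] at this
    have h0 : ⌈2 * √((0 : ℕ) : ℝ) - 1⌉ = -1 := by
      rw [Nat.cast_zero, Real.sqrt_zero, mul_zero, zero_sub]
      exact_mod_cast Int.ceil_intCast (R := ℝ) (-1)
    omega
  obtain ⟨s, hsm, hs, hcount⟩ := exists_pinwheel_count hm
  have hceil := le_ceil_two_mul_sqrt_sub_one hs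
  have hk : 0 < m.sqrt := Nat.sqrt_pos.2 (Nat.pos_of_ne_zero hm)
  have hidx : ∀ c r, r < m.sqrt → c * m.sqrt + r < m →
      ∃ i : Fin m, (i : ℕ) / m.sqrt = c ∧ (i : ℕ) % m.sqrt = r := by
    intro c r hr hcr
    refine ⟨⟨c * m.sqrt + r, hcr⟩, ?_, ?_⟩
    · simp only [mul_comm c, Nat.mul_add_div hk, Nat.div_eq_of_lt hr, add_zero]
    · simp only [mul_comm c, Nat.mul_add_mod, Nat.mod_eq_of_lt hr]
  let col : Fin (m - s) → ℕ := fun x => x / (m.sqrt - 1)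
  let row : Fin (m - s) → ℕ := fun x => x % (m.sqrt - 1)
  have hrow : ∀ x, row x + 1 < m.sqrt := fun x => by
    have := Nat.mod_lt x (hcount x x.2).1
    simp only [row]; omega
  have hlast : ∀ x, (col x + 1) * m.sqrt + (row x + 1) < m := fun x => by
    have := (hcount x x.2).2
    simp only [row, col, add_mul]; omega
  have hfour : ∀ x c r, (c = col x ∨ c = col x + 1) → (r = row x ∨ r = row x + 1) →
      ∃ i : Fin m, (i : ℕ) / m.sqrt = c ∧ (i : ℕ) % m.sqrt = r := by
    intro x c r hc hr
    have h1 := hrow x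
    have h2 := hlast x
    refine hidx c r (by omega) ?_
    have : c * m.sqrt ≤ (col x + 1) * m.sqrt := Nat.mul_le_mul_right _ (by omega)
    omega
  let w : Fin (m - s) ⊕ Fin T → ℝ × ℝ := Sum.elim (fun x => pinwheelCenter (col x) (row x))
    fun k => ((10 * m + 10 : ℝ) + ((k + 1 : ℕ) : ℝ), stairHeight (10 * m + 10) (k + 1))
  have hpos : ∀ x, 0 < (pinwheelCenter (col x) (row x)).2 := fun x => by
    simp only [pinwheelCenter]; positivity
  have hneg : ∀ k : ℕ, stairHeight (10 * m + 10) (k + 1) < 0 := fun k => by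
    rw [stairHeight_succ]
    have : (0 : ℝ) ≤ k := k.cast_nonneg
    linarith
  have hmixed : ∀ x (k : Fin T) R, IsAxisRect R → R ⊆ staircase (10 * m + 10) T →
      w (Sum.inl x) ∈ R → w (Sum.inr k) ∈ R → False := by
    intro x k R hR hsub hx hk
    have h1 := hR.le_stairHeight hM hsub hk hx
    exact absurd h1 (not_le.2 ((hneg k).trans (hpos x)))
  have hcenters : ∀ x y R, col x < col y ∨ col x = col y ∧ row x < row y → IsAxisRect R →
      w (Sum.inl x) ∈ R → w (Sum.inl y) ∈ R →
      ∃ i, (R ∩ interior (checkerboard m i)).Nonempty := by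
    intro x y R hxy hR hx hy
    obtain ⟨c, r, hc, hr, hn⟩ := hR.exists_topping_of_centers hx hy hxy
    obtain ⟨i, rfl, rfl⟩ := hfour x c r hc hr
    exact ⟨i, hn⟩
  have := h.card_le w ?_ ?_ ?_
  · simp only [Fintype.card_sum, Fintype.card_fin] at this
    omega
  · rintro (x | k)
    · have h1 := hrow x
      have h2 := hlast x
      refine pinwheelCenter_mem_staircase ?_ (by have := Nat.sqrt_le_self m; omega) T
      have : col x * 1 ≤ col x * m.sqrt := Nat.mul_le_mul_left _ hk
      simp only [add_mul] at h2
      omega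
    · exact corner_mem_staircase hM k.2
  · rintro (x | k) i R hR hsub hx hi
    · obtain ⟨c, r, hc, hr, hne, hn⟩ := hR.exists_topping_of_center hx hi
      obtain ⟨i', rfl, rfl⟩ := hfour x c r hc hr
      refine ⟨i', ?_, hn⟩
      rintro rfl
      simp at hne
    · have h1 := hR.le_stairHeight hM hsub hx
        (hi (interior_subset (center_mem_interior_topping _ _)))
      have h2 := h1.trans_lt (hneg k)
      simp only at h2
      rw [← Int.cast_zero, Int.cast_lt] at h2
      omega
  · rintro (x | k) (y | k') R hne hR hsub hx hy
    · have hxy : x ≠ y := fun h => hne (by rw [h])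
      have hcr : col x ≠ col y ∨ row x ≠ row y := by
        by_contra! hcon
        apply hxy
        apply Fin.ext
        rw [← Nat.div_add_mod x (m.sqrt - 1), ← Nat.div_add_mod y (m.sqrt - 1)]
        exact congrArg₂ _ (congrArg _ hcon.1) hcon.2
      by_cases hlt : col x < col y ∨ col x = col y ∧ row x < row y
      · exact hcenters x y R hlt hR hx hy
      · exact hcenters y x R (by omega) hR hy hx
    · exact (hmixed x k' R hR hsub hx hy).elim
    · exact (hmixed y k R hR hsub hy hx).elim
    · refine (hcorner (k + 1) (k' + 1) R (fun h => hne ?_) hR hsub hx hy).elim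
      rw [Fin.ext (by omega : (k : ℕ) = k')]

theorem theorem6 :
    (∀ (m T : ℕ) (C : Set (ℝ × ℝ)) (Z : Fin m → Set (ℝ × ℝ)),
      IsSimplyConnectedRectilinearPolygon C →
      {p | IsReflexVertex C p}.encard = (T : ℕ∞) →
      (∀ i, IsAxisRect (Z i) ∧ Z i ⊆ C) →
      (∀ i j, i ≠ j → Disjoint (interior (Z i)) (interior (Z j))) →
      ∃ b : ℕ, (b : ℤ) ≤ (m : ℤ) + (T : ℤ) - ⌈2 * √(m : ℝ) - 1⌉ ∧ HasExpansion C Z b) ∧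
    (∀ m T : ℕ, ∃ (C : Set (ℝ × ℝ)) (Z : Fin m → Set (ℝ × ℝ)),
      IsSimplyConnectedRectilinearPolygon C ∧
      {p | IsReflexVertex C p}.encard = (T : ℕ∞) ∧
      (∀ i, IsAxisRect (Z i) ∧ Z i ⊆ C) ∧
      (∀ i j, i ≠ j → Disjoint (Z i) (Z j)) ∧
      ∃ b₀ : ℕ, (b₀ : ℤ) = (m : ℤ) + (T : ℤ) - ⌈2 * √(m : ℝ) - 1⌉ ∧
        IsLeast {b : ℕ | HasExpansion C Z b} b₀) := by
  refine ⟨fun m T C Z hC hT hZ hdisj => exists_hasExpansion_le hC hT hZ hdisj, fun m T => ?_⟩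
  have hM : (0 : ℝ) < 10 * m + 10 := by positivity
  have hC := isSimplyConnectedRectilinearPolygon_staircase hM T
  have hT := encard_isReflexVertex_staircase hM T
  have hZ : ∀ i : Fin m, IsAxisRect (checkerboard m i) ∧
      checkerboard m i ⊆ staircase (10 * m + 10) T := fun i =>
    ⟨isAxisRect_topping _ _, topping_subset_staircase ((Nat.div_le_self _ _).trans i.2.le)
      ((Nat.mod_le _ _).trans i.2.le) T⟩
  have hdisj : ∀ i j : Fin m, i ≠ j → Disjoint (checkerboard m i) (checkerboard m j) := by
    intro i j hij
    refine disjoint_topping ?_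
    by_contra! hcon
    apply hij
    apply Fin.ext
    rw [← Nat.div_add_mod i m.sqrt, ← Nat.div_add_mod j m.sqrt, hcon.1, hcon.2]
  obtain ⟨b, hb, hexp⟩ := exists_hasExpansion_le hC hT hZ
    fun i j hij => (hdisj i j hij).mono interior_subset interior_subset
  refine ⟨_, _, hC, hT, hZ, hdisj, b, le_antisymm hb hexp.le_of_checkerboard, hexp,
    fun b' hb' => ?_⟩
  have := HasExpansion.le_of_checkerboard hb'
  omega
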